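/- For $\varepsilon=\pm1$ let $I_\varepsilon$ be a set with at least two elements and a distinguished element $\iota_\varepsilon\in I_\varepsilon$, and let $\Sigma_\varepsilon$ be a transitive permutation group on $I_\varepsilon$. Let $\Gamma=\Sigma_{-1}\cdot\Sigma_1$ be the corresponding permutation group on the disjoint union $I_{-1}\sqcup I_1$, and let $\Gamma_\varepsilon$ be the stabilizer of $\iota_\varepsilon$ in $\Gamma$. An admissible sequence is a finite sequence $w=(i_1,\varepsilon_1,\dots,i_n,\varepsilon_n)$, $n\ge 0$, with $\varepsilon_t\in\{-1,1\}$, $i_t\in I_{-\varepsilon_t}$, and $i_t\neq\iota_{-\varepsilon_t}$ whenever $\varepsilon_t\varepsilon_{t-1}=-1$; put $\Gamma_w=\Gamma_{\varepsilon_n}$ if $n\ge1$ and $\Gamma_w=\Gamma$ if $w$ is empty. Let $G$ be the group generated by symbols $h(w;\sigma)$, where $w$ is an admissible sequence and $\sigma\in\Gamma_w$ (written $h(\sigma)$ if $w$ is empty), subject to the following relations: * $h(w;\sigma)\,h(w;\sigma')=h(w;\sigma\sigma')$; * $h(w;\sigma)\,h(w,i,\varepsilon,v;\rho)\,h(w;\sigma)^{-1}=h(w,\sigma(i),\varepsilon,v;\rho)$;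 * $h(w;\sigma)$ and $h(v;\rho)$ commute if the length of $w$ is at most the length of $v$ and $w$ is not an initial segment of $v$. For $\varepsilon=\pm1$ let $H_\varepsilon\le G$ be the subgroup generated by all $h(w;\sigma)$ with $w$ non-empty and all $h(\sigma)$ with $\sigma\in\Gamma_\varepsilon$, and let $H=H_{-1}$. Let $\theta:H_{-1}\to H_1$ be the isomorphism given on these generators by $$\theta(h(\sigma))=h(\iota_1,-1;\sigma),\qquad \theta(h(\iota_{-1},1,w;\sigma))=h(w;\sigma),\qquad \theta(h(w;\sigma))=h(\iota_1,-1,w;\sigma),$$ where in the first formula $\sigma\in\Gamma_{-1}$ and in the last one $w$ is non-empty and does not begin with $(\iota_{-1},1)$. Let $$\Lambda[\Sigma_{-1},\Sigma_1]=\operatorname{HNN}(G,H,\theta)=\langle G,\tau\mid \tau^{-1}h\tau=\theta(h)\text{ for all }h\in H\rangle .$$ Then $\Lambda[\Sigma_{-1},\Sigma_1]$ is not inner amenable, that is, there is no positive, finitely additive probability measure on the set of all subsets of $\Lambda[\Sigma_{-1},\Sigma_1]\setminus\{1\}$ that is invariant under conjugation. -/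

import Mathlib

namespace HNNFamily

universe u

/-- Conjugation by `g` on `G ∖ {1}`. -/
def conjNeOne {G : Type*} [Group G] (g : G) (x : {x : G // x ≠ 1}) : {x : G // x ≠ 1} :=
  ⟨g * x * g⁻¹, fun h => x.2 (conj_eq_one_iff.mp h)⟩

/-- `G` is inner amenable: there is a positive, finitely additive probability measure, defined on
all subsets of `G ∖ {1}`, that is invariant under conjugation by the elements of `G`. -/
def InnerAmenable (G : Type*) [Group G] : Prop :=
  ∃ μ : Set {x : G // x ≠ 1} → ℝ,
    (∀ A, 0 ≤ μ A) ∧ μ Set.univ = 1 ∧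
    (∀ A B, Disjoint A B → μ (A ∪ B) = μ A + μ B) ∧
    ∀ (g : G) (A : Set {x : G // x ≠ 1}), μ (conjNeOne g '' A) = μ A

/-- The disjoint union `I₋₁ ⊔ I₁`; the signs `ε = ±1` are the elements of `ℤˣ`.
The pair `(i, ε)` with `i ∈ I_{-ε}` is encoded by the letter `⟨-ε, i⟩`, so the sign `ε` that goes
with a letter `x` is `-x.1`. -/
abbrev Letter (I : ℤˣ → Type u) : Type u := Σ ε : ℤˣ, I ε

section

variable {I : ℤˣ → Type u} (ι : ∀ ε, I ε) (S : ∀ ε, Subgroup (Equiv.Perm (I ε)))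

/-- The base point `ι_ε` as an element of `I₋₁ ⊔ I₁`. -/
def base (ε : ℤˣ) : Letter I := ⟨ε, ι ε⟩

/-- For a letter `x` with sign `ε = -x.1` this is the base point `ι_ε`. -/
def back (x : Letter I) : Letter I := base ι (-x.1)

/-- `Γ = Σ₋₁ · Σ₁`, as a permutation group on `I₋₁ ⊔ I₁`. -/
def prodGroup : Subgroup (Equiv.Perm (Letter I)) :=
  (Subgroup.pi Set.univ S).map (Equiv.Perm.sigmaCongrRightHom I)

/-- The sequences `(i₁, ε₁, …, iₙ, εₙ)`, `n ≥ 0`, with `i_t ∈ I_{-ε_t}`, and with `i_t ≠ ι_{-ε_t}`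
whenever `ε_t ε_{t-1} = -1`. -/
def IsReduced (w : List (Letter I)) : Prop :=
  w.IsChain fun x y => y.1 = -x.1 → y ≠ base ι y.1

/-- The symbols `h(i₁, ε₁, …, iₙ, εₙ; σ)`, where `σ ∈ Γ` fixes `ι_{εₙ}` if `n ≥ 1`; for `n = 0`
these are the symbols `h(σ)`, where `σ ∈ Γ` is arbitrary. -/
@[ext]
structure Gen where
  word : List (Letter I)
  perm : Equiv.Perm (Letter I)
  reduced : IsReduced ι word
  mem : perm ∈ prodGroup S
  fix : ∀ x ∈ word.getLast?, perm (back ι x) = back ι x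

variable {ι S}

/-- `h(w; σ) h(w; σ') = h(w; σσ')`. -/
def RelMul (a b c : Gen ι S) : Prop :=
  a.word = c.word ∧ b.word = c.word ∧ c.perm = a.perm * b.perm

/-- `h(w; σ) h(w, x, v; ρ) h(w; σ)⁻¹ = h(w, σ(x), v; ρ)`. -/
def RelConj (a b c : Gen ι S) : Prop :=
  ∃ x v, b.word = a.word ++ x :: v ∧ c.word = a.word ++ a.perm x :: v ∧ c.perm = b.perm

/-- `h(w; σ)` and `h(v; ρ)` commute if `w` is not longer than `v` and is not an initial
segment of `v`. -/
def RelComm (a b : Gen ι S) : Prop :=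
  a.word.length ≤ b.word.length ∧ ¬ a.word <+: b.word

variable (ι S)

/-- The defining relators of the group `G`. (That `h(σ)` and `h(σ')` commute for `σ ∈ Σ₋₁` and
`σ' ∈ Σ₁` is contained in the first family.) -/
def rels : Set (FreeGroup (Gen ι S)) :=
  {r | ∃ a b c, RelMul a b c ∧ r = .of a * .of b * (.of c)⁻¹} ∪
  {r | ∃ a b c, RelConj a b c ∧ r = .of a * .of b * (.of a)⁻¹ * (.of c)⁻¹} ∪
  {r | ∃ a b, RelComm a b ∧ r = .of a * .of b * (.of a)⁻¹ * (.of b)⁻¹}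

/-- The group `G`, generated by the symbols `h(i₁, ε₁, …, iₙ, εₙ; σ)`, `n ≥ 0`. -/
abbrev VertexGroup : Type u := PresentedGroup (rels ι S)

variable {ι S}

/-- The element `h(i₁, ε₁, …, iₙ, εₙ; σ)` of `G`. -/
def gen (a : Gen ι S) : VertexGroup ι S := PresentedGroup.of a

/-- The symbols that generate `H_ε`: all `h(i₁, ε₁, …, iₙ, εₙ; σ)` with `n ≥ 1`, and the `h(σ)`
with `σ(ι_ε) = ι_ε`. -/
def Gen.IsEdge (ε : ℤˣ) (a : Gen ι S) : Prop := a.word = [] → a.perm (base ι ε) = base ι ε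

variable (ι S)

/-- The subgroup `H_ε` of `G`. -/
def edgeGroup (ε : ℤˣ) : Subgroup (VertexGroup ι S) :=
  Subgroup.closure {g | ∃ a : Gen ι S, a.IsEdge ε ∧ gen a = g}

variable {S}

open Classical in
/-- The effect of `θ^{-ε}` on sequences: a first entry `(ι_ε, -ε)` is removed, and if the sequence
does not begin with `(ι_ε, -ε)`, then `(ι_{-ε}, ε)` is put in front of it. -/
noncomputable def shiftWord (ε : ℤˣ) : List (Letter I) → List (Letter I)
  | [] => [base ι (-ε)]
  | x :: w => if x = base ι ε then w else base ι (-ε) :: x :: w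

variable {ι}

theorem prodGroup_fst {σ : Equiv.Perm (Letter I)} (h : σ ∈ prodGroup S) (x : Letter I) :
    (σ x).1 = x.1 := by
  obtain ⟨τ, -, rfl⟩ := h
  rfl

theorem back_congr {x y : Letter I} (h : x.1 = y.1) : back ι x = back ι y := by
  simp [back, h]

theorem isReduced_iff {w : List (Letter I)} :
    IsReduced ι w ↔ w.IsChain fun x y => y ≠ back ι x := by
  have : (fun x y : Letter I => y.1 = -x.1 → y ≠ base ι y.1) = fun x y => y ≠ back ι x := by
    funext x y
    apply propext
    constructor
    · rintro h rfl
      exact h rfl rfl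
    · intro h h1 h2
      exact h (by rw [h2, h1]; rfl)
  rw [IsReduced, this]

theorem isReduced_cons_cons {x y : Letter I} {w : List (Letter I)} :
    IsReduced ι (x :: y :: w) ↔ y ≠ back ι x ∧ IsReduced ι (y :: w) := by
  simp [isReduced_iff]

theorem isReduced_nil : IsReduced ι ([] : List (Letter I)) := by simp [isReduced_iff]

theorem isReduced_singleton (x : Letter I) : IsReduced ι [x] := by simp [isReduced_iff]

theorem isReduced_tail {x : Letter I} {w : List (Letter I)} (h : IsReduced ι (x :: w)) :
    IsReduced ι w := by
  rw [isReduced_iff] at *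
  exact h.tail

theorem back_base (ε : ℤˣ) : back ι (base ι ε) = base ι (-ε) := rfl

theorem back_base_neg (ε : ℤˣ) : back ι (base ι (-ε)) = base ι ε := by
  rw [back_base, neg_neg]

theorem isReduced_shiftWord (ε : ℤˣ) {w : List (Letter I)} (h : IsReduced ι w) :
    IsReduced ι (shiftWord ι ε w) := by
  cases w with
  | nil => exact isReduced_singleton _
  | cons x w =>
    rw [shiftWord]
    split_ifs with hx
    · exact isReduced_tail h
    · exact isReduced_cons_cons.2 ⟨by rwa [back_base_neg], h⟩

/-- The effect of `θ^{-ε}` on the generators of `H_ε`: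
`θ^{-ε}(h(σ)) = h(ι_{-ε}, ε; σ)`, `θ^{-ε}(h(ι_ε, -ε, w; σ)) = h(w; σ)`, and
`θ^{-ε}(h(w; σ)) = h(ι_{-ε}, ε, w; σ)` if `w` is not empty and does not begin with `(ι_ε, -ε)`. -/
noncomputable def Gen.shift (ε : ℤˣ) (a : Gen ι S) (ha : a.IsEdge ε) : Gen ι S where
  word := shiftWord ι ε a.word
  perm := a.perm
  reduced := isReduced_shiftWord ε a.reduced
  mem := a.mem
  fix := by
    have h1 := a.fix
    rcases hw : a.word with _ | ⟨x, w⟩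
    · simpa [shiftWord, back_base_neg] using ha hw
    · rw [hw] at h1
      rw [shiftWord]
      split_ifs with hx
      · rcases w with _ | ⟨y, w⟩
        · simp
        · simpa using h1
      · simpa using h1

theorem gen_mul {a b c : Gen ι S} (h : RelMul a b c) : gen a * gen b = gen c := by
  have := PresentedGroup.one_of_mem (rels := rels ι S)
    (x := .of a * .of b * (.of c)⁻¹) (Or.inl (Or.inl ⟨a, b, c, h, rfl⟩))
  rw [map_mul, map_inv, mul_inv_eq_one, map_mul] at this
  exact this

theorem gen_conj {a b c : Gen ι S} (h : RelConj a b c) : gen a * gen b = gen c * gen a := by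
  have := PresentedGroup.one_of_mem (rels := rels ι S)
    (x := .of a * .of b * (.of a)⁻¹ * (.of c)⁻¹) (Or.inl (Or.inr ⟨a, b, c, h, rfl⟩))
  rw [map_mul, map_inv, mul_inv_eq_one, map_mul, map_inv, mul_inv_eq_iff_eq_mul, map_mul] at this
  exact this

theorem gen_comm {a b : Gen ι S} (h : RelComm a b) : gen a * gen b = gen b * gen a := by
  have := PresentedGroup.one_of_mem (rels := rels ι S)
    (x := .of a * .of b * (.of a)⁻¹ * (.of b)⁻¹) (Or.inr ⟨a, b, h, rfl⟩)
  rw [map_mul, map_inv, mul_inv_eq_one, map_mul, map_inv, mul_inv_eq_iff_eq_mul, map_mul] at this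
  exact this

theorem gen_eq_one {a : Gen ι S} (h : a.perm = 1) : gen a = 1 := by
  have : gen a * gen a = gen a := gen_mul ⟨rfl, rfl, by simp [h]⟩
  simpa using this

theorem gen_comm_of_incomp {a b : Gen ι S} (h : ¬ a.word <+: b.word) (h' : ¬ b.word <+: a.word) :
    gen a * gen b = gen b * gen a := by
  rcases le_total a.word.length b.word.length with hl | hl
  · exact gen_comm ⟨hl, h⟩
  · exact (gen_comm ⟨hl, h'⟩).symm

theorem gen_comm_of_fix {a b : Gen ι S} {x : Letter I} {v : List (Letter I)}
    (ha : a.word = []) (hb : b.word = x :: v) (hx : a.perm x = x) :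
    gen a * gen b = gen b * gen a :=
  gen_conj ⟨x, v, by simp [ha, hb], by simp [ha, hb, hx], rfl⟩

theorem shiftWord_append (ε : ℤˣ) {w : List (Letter I)} (hw : w ≠ []) (v : List (Letter I)) :
    shiftWord ι ε (w ++ v) = shiftWord ι ε w ++ v := by
  cases w with
  | nil => exact absurd rfl hw
  | cons x w =>
    simp only [List.cons_append, shiftWord]
    split_ifs <;> simp

theorem shiftWord_base (ε : ℤˣ) (w : List (Letter I)) :
    shiftWord ι ε (base ι ε :: w) = w := by simp [shiftWord]

theorem shiftWord_cons {ε : ℤˣ} {x : Letter I} (h : x ≠ base ι ε) (w : List (Letter I)) :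
    shiftWord ι ε (x :: w) = base ι (-ε) :: x :: w := by simp [shiftWord, h]

theorem not_reduced_base {ε : ℤˣ} {v : List (Letter I)} :
    ¬ IsReduced ι (base ι ε :: base ι (-ε) :: v) := fun h =>
  (isReduced_cons_cons.1 h).1 rfl

theorem perm_base_neg {ε : ℤˣ} {a : Gen ι S} (h : a.word = [base ι ε]) :
    a.perm (base ι (-ε)) = base ι (-ε) := by
  have := a.fix (base ι ε) (by simp [h])
  rwa [back_base] at this

theorem gen_comm_shift {ε : ℤˣ} {a a' b' : Gen ι S} {u v : List (Letter I)}
    (ha : a.word = base ι ε :: u) (ha' : a'.word = u) (hp : a'.perm = a.perm)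
    (hb' : b'.word = base ι (-ε) :: v) :
    gen a' * gen b' = gen b' * gen a' := by
  rcases u with _ | ⟨y, u⟩
  · refine gen_comm_of_fix ha' hb' ?_
    rw [hp]
    exact perm_base_neg ha
  · have hy : y ≠ base ι (-ε) := by
      rintro rfl
      exact not_reduced_base (ha ▸ a.reduced)
    refine gen_comm_of_incomp ?_ ?_
    · rw [ha', hb', List.cons_prefix_cons]
      exact fun h => hy h.1
    · rw [ha', hb', List.cons_prefix_cons]
      exact fun h => hy h.1.symm

theorem shift_conj {ε : ℤˣ} {a b c : Gen ι S} (ha : a.IsEdge ε) (hb : b.IsEdge ε)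
    (hc : c.IsEdge ε) (h : RelConj a b c) :
    gen (a.shift ε ha) * gen (b.shift ε hb) = gen (c.shift ε hc) * gen (a.shift ε ha) := by
  obtain ⟨x, v, h1, h2, h3⟩ := h
  by_cases hw : a.word = []
  · rw [hw, List.nil_append] at h1 h2
    have hfix := ha hw
    by_cases hx : x = base ι ε
    · subst hx
      rw [hfix] at h2
      have hcb : c = b := Gen.ext (h2.trans h1.symm) h3
      subst hcb
      symm
      refine gen_comm_shift (v := []) h1 ?_ rfl ?_
      · simp only [Gen.shift, h1, shiftWord_base]
      · simp only [Gen.shift, hw, shiftWord]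
    · have hx' : a.perm x ≠ base ι ε := fun h => hx (a.perm.injective (h.trans hfix.symm))
      refine gen_conj ⟨x, v, ?_, ?_, h3⟩
      · simp only [Gen.shift, hw, h1, shiftWord_cons hx]
        simp [shiftWord]
      · simp only [Gen.shift, hw, h2, shiftWord_cons hx']
        simp [shiftWord]
  · refine gen_conj ⟨x, v, ?_, ?_, h3⟩
    · simp only [Gen.shift, h1, shiftWord_append ε hw]
    · simp only [Gen.shift, h2, shiftWord_append ε hw]

theorem shift_comm {ε : ℤˣ} {a b : Gen ι S} (ha : a.IsEdge ε) (hb : b.IsEdge ε)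
    (h : RelComm a b) :
    gen (a.shift ε ha) * gen (b.shift ε hb) = gen (b.shift ε hb) * gen (a.shift ε ha) := by
  obtain ⟨h1, h2⟩ := h
  rcases hu : a.word with _ | ⟨x, u⟩
  · exact absurd (hu ▸ List.nil_prefix) h2
  rcases hv : b.word with _ | ⟨y, v⟩
  · rw [hu, hv] at h1
    simp at h1
  rw [hu, hv] at h1 h2
  by_cases hx : x = base ι ε <;> by_cases hy : y = base ι ε
  · subst hx hy
    refine gen_comm ⟨?_, ?_⟩
    · simpa [Gen.shift, hu, hv, shiftWord_base] using h1
    · simpa [Gen.shift, hu, hv, shiftWord_base, List.cons_prefix_cons] using h2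
  · subst hx
    refine gen_comm_shift (v := y :: v) hu ?_ rfl ?_
    · simp only [Gen.shift, hu, shiftWord_base]
    · simp only [Gen.shift, hv, shiftWord_cons hy]
  · subst hy
    symm
    refine gen_comm_shift (v := x :: u) hv ?_ rfl ?_
    · simp only [Gen.shift, hv, shiftWord_base]
    · simp only [Gen.shift, hu, shiftWord_cons hx]
  · refine gen_comm ⟨?_, ?_⟩
    · simpa [Gen.shift, hu, hv, shiftWord_cons hx, shiftWord_cons hy] using h1
    · simp only [Gen.shift, hu, hv, shiftWord_cons hx, shiftWord_cons hy,
        List.prefix_cons_inj]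
      exact h2

/-- The orbit of `ι_ε` under `Γ`. -/
def Orbit (S : ∀ ε, Subgroup (Equiv.Perm (I ε))) (ι : ∀ ε, I ε) (ε : ℤˣ) : Type u :=
  {x : Letter I // ∃ σ ∈ prodGroup S, σ (base ι ε) = x}

open Classical in
/-- An element of `Γ` that maps `ι_ε` to `y`. -/
noncomputable def rep {ε : ℤˣ} (y : Orbit S ι ε) : Equiv.Perm (Letter I) :=
  if y.1 = base ι ε then 1 else y.2.choose

theorem rep_mem {ε : ℤˣ} (y : Orbit S ι ε) : rep y ∈ prodGroup S := by
  rw [rep]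
  split_ifs
  · exact one_mem _
  · exact y.2.choose_spec.1

theorem rep_apply {ε : ℤˣ} (y : Orbit S ι ε) : rep y (base ι ε) = y.1 := by
  rw [rep]
  split_ifs with h
  · exact h.symm
  · exact y.2.choose_spec.2

/-- The base point of the orbit. -/
def orbitBase (S : ∀ ε, Subgroup (Equiv.Perm (I ε))) (ι : ∀ ε, I ε) (ε : ℤˣ) : Orbit S ι ε :=
  ⟨base ι ε, 1, one_mem _, rfl⟩

theorem rep_base (ε : ℤˣ) : rep (orbitBase S ι ε) = 1 := by simp [rep, orbitBase]

/-- Application of a permutation to the first letter of a sequence. -/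
def mapHead (σ : Equiv.Perm (Letter I)) : List (Letter I) → List (Letter I)
  | [] => []
  | x :: w => σ x :: w

theorem isReduced_mapHead {σ : Equiv.Perm (Letter I)} (hσ : σ ∈ prodGroup S)
    {w : List (Letter I)} (h : IsReduced ι w) : IsReduced ι (mapHead σ w) := by
  rcases w with _ | ⟨x, _ | ⟨y, w⟩⟩
  · exact h
  · exact isReduced_singleton _
  · rw [mapHead, isReduced_cons_cons]
    rw [isReduced_cons_cons] at h
    rw [back_congr (prodGroup_fst hσ x)]
    exact h

/-- The symbol `h(σ(i₁), ε₁, i₂, ε₂, …; ρ)`. -/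
def Gen.translate (a : Gen ι S) (σ : Equiv.Perm (Letter I)) (hσ : σ ∈ prodGroup S) : Gen ι S where
  word := mapHead σ a.word
  perm := a.perm
  reduced := isReduced_mapHead hσ a.reduced
  mem := a.mem
  fix := by
    have h1 := a.fix
    rcases hw : a.word with _ | ⟨x, _ | ⟨y, w⟩⟩
    · simp [mapHead]
    · rw [hw] at h1
      simpa [mapHead, back_congr (prodGroup_fst hσ x)] using h1
    · rw [hw] at h1
      simpa [mapHead] using h1

open Classical in
/-- The action of a generator of `G` on the orbit of `ι_ε`. -/
noncomputable def Gen.move {ε : ℤˣ} (a : Gen ι S) (y : Orbit S ι ε) : Orbit S ι ε :=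
  if a.word = [] then
    ⟨a.perm y.1, a.perm * rep y, mul_mem a.mem (rep_mem y), by
      rw [Equiv.Perm.mul_apply, rep_apply]⟩
  else y

open Classical in
/-- The generator `h(μ)⁻¹ a h(ν)` of `H_ε`, where `ν` and `μ` are the representatives that belong
to `y` and to the image of `y` under `a`. -/
noncomputable def Gen.cocycle {ε : ℤˣ} (a : Gen ι S) (y : Orbit S ι ε) : Gen ι S :=
  if h : a.word = [] then
    { word := []
      perm := (rep (a.move y))⁻¹ * a.perm * rep y
      reduced := isReduced_nil
      mem := mul_mem (mul_mem (inv_mem (rep_mem _)) a.mem) (rep_mem y)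
      fix := by simp }
  else a.translate (rep y)⁻¹ (inv_mem (rep_mem y))

theorem move_nil {ε : ℤˣ} {a : Gen ι S} (h : a.word = []) (y : Orbit S ι ε) :
    (a.move y).1 = a.perm y.1 := by simp [Gen.move, h]

theorem move_of_ne {ε : ℤˣ} {a : Gen ι S} (h : a.word ≠ []) (y : Orbit S ι ε) :
    a.move y = y := by simp [Gen.move, h]

theorem cocycle_word {ε : ℤˣ} (a : Gen ι S) (y : Orbit S ι ε) :
    (a.cocycle y).word = mapHead (rep y)⁻¹ a.word := by
  rw [Gen.cocycle]
  split_ifs with h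
  · simp [h, mapHead]
  · rfl

theorem cocycle_perm_nil {ε : ℤˣ} {a : Gen ι S} (h : a.word = []) (y : Orbit S ι ε) :
    (a.cocycle y).perm = (rep (a.move y))⁻¹ * a.perm * rep y := by
  rw [Gen.cocycle, dif_pos h]

theorem cocycle_perm_of_ne {ε : ℤˣ} {a : Gen ι S} (h : a.word ≠ []) (y : Orbit S ι ε) :
    (a.cocycle y).perm = a.perm := by
  rw [Gen.cocycle, dif_neg h]
  rfl

theorem mapHead_eq_nil {σ : Equiv.Perm (Letter I)} {w : List (Letter I)} :
    mapHead σ w = [] ↔ w = [] := by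
  cases w <;> simp [mapHead]

theorem mapHead_append {σ : Equiv.Perm (Letter I)} {w : List (Letter I)} (h : w ≠ [])
    (v : List (Letter I)) : mapHead σ (w ++ v) = mapHead σ w ++ v := by
  cases w with
  | nil => exact absurd rfl h
  | cons x w => simp [mapHead]

theorem cocycle_isEdge {ε : ℤˣ} (a : Gen ι S) (y : Orbit S ι ε) : (a.cocycle y).IsEdge ε := by
  intro h
  rw [cocycle_word, mapHead_eq_nil] at h
  rw [cocycle_perm_nil h, Equiv.Perm.mul_apply, Equiv.Perm.mul_apply, rep_apply,
    Equiv.Perm.inv_eq_iff_eq, rep_apply, move_nil h]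

theorem move_mul {ε : ℤˣ} {a b c : Gen ι S} (h : RelMul a b c) (y : Orbit S ι ε) :
    c.move y = a.move (b.move y) := by
  obtain ⟨h1, h2, h3⟩ := h
  by_cases hc : c.word = []
  · apply Subtype.ext
    rw [move_nil hc, move_nil (h1.trans hc), move_nil (h2.trans hc), h3, Equiv.Perm.mul_apply]
  · rw [move_of_ne hc, move_of_ne (h1 ▸ hc), move_of_ne (h2 ▸ hc)]

theorem cocycle_mul {ε : ℤˣ} {a b c : Gen ι S} (h : RelMul a b c) (y : Orbit S ι ε) :
    RelMul (a.cocycle (b.move y)) (b.cocycle y) (c.cocycle y) := by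
  have hm := move_mul h y
  obtain ⟨h1, h2, h3⟩ := h
  by_cases hc : c.word = []
  · have ha := h1.trans hc
    have hb := h2.trans hc
    refine ⟨by simp [cocycle_word, ha, hc, mapHead], by simp [cocycle_word, hb, hc, mapHead], ?_⟩
    rw [cocycle_perm_nil ha, cocycle_perm_nil hb, cocycle_perm_nil hc, hm, h3]
    group
  · have ha : a.word ≠ [] := h1 ▸ hc
    have hb : b.word ≠ [] := h2 ▸ hc
    refine ⟨by rw [cocycle_word, cocycle_word, move_of_ne hb, h1], by
      rw [cocycle_word, cocycle_word, h2], ?_⟩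
    rw [cocycle_perm_of_ne ha, cocycle_perm_of_ne hb, cocycle_perm_of_ne hc, h3]

theorem RelConj.ne_nil {a b c : Gen ι S} (h : RelConj a b c) : b.word ≠ [] ∧ c.word ≠ [] := by
  obtain ⟨x, v, h1, h2, -⟩ := h
  simp [h1, h2]

theorem cocycle_conj {ε : ℤˣ} {a b c : Gen ι S} (h : RelConj a b c) (y : Orbit S ι ε) :
    RelConj (a.cocycle y) (b.cocycle y) (c.cocycle (a.move y)) := by
  obtain ⟨hb, hc⟩ := h.ne_nil
  obtain ⟨x, v, h1, h2, h3⟩ := h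
  by_cases ha : a.word = []
  · refine ⟨(rep y)⁻¹ x, v, ?_, ?_, ?_⟩
    · simp [cocycle_word, ha, h1, mapHead]
    · simp [cocycle_word, cocycle_perm_nil ha, ha, h2, mapHead]
    · rw [cocycle_perm_of_ne hb, cocycle_perm_of_ne hc, h3]
  · refine ⟨x, v, ?_, ?_, ?_⟩
    · rw [cocycle_word, cocycle_word, h1, mapHead_append ha]
    · rw [cocycle_word, cocycle_word, h2, mapHead_append ha, move_of_ne ha,
        cocycle_perm_of_ne ha]
    · rw [cocycle_perm_of_ne hb, cocycle_perm_of_ne hc, h3]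

theorem RelComm.ne_nil {a b : Gen ι S} (h : RelComm a b) : a.word ≠ [] ∧ b.word ≠ [] := by
  obtain ⟨h1, h2⟩ := h
  have : a.word ≠ [] := fun h => h2 (h ▸ List.nil_prefix)
  refine ⟨this, fun h => this ?_⟩
  rw [h] at h1
  simpa using h1

theorem cocycle_comm {ε : ℤˣ} {a b : Gen ι S} (h : RelComm a b) (y : Orbit S ι ε) :
    RelComm (a.cocycle y) (b.cocycle y) := by
  obtain ⟨ha, hb⟩ := h.ne_nil
  obtain ⟨h1, h2⟩ := h
  rw [RelComm, cocycle_word, cocycle_word]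
  rcases hu : a.word with _ | ⟨x, u⟩
  · exact absurd hu ha
  rcases hv : b.word with _ | ⟨z, v⟩
  · exact absurd hv hb
  rw [hu, hv] at h1 h2
  refine ⟨by simpa [mapHead] using h1, ?_⟩
  simpa [mapHead, List.cons_prefix_cons] using h2

/-- The map of the product of the orbit of `ι_ε` and `G` into itself that a generator induces. -/
noncomputable def Gen.act (ε : ℤˣ) (a : Gen ι S) (z : Orbit S ι ε × VertexGroup ι S) :
    Orbit S ι ε × VertexGroup ι S :=
  (a.move z.1, gen ((a.cocycle z.1).shift ε (cocycle_isEdge a z.1)) * z.2)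

theorem act_mul {ε : ℤˣ} {a b c : Gen ι S} (h : RelMul a b c)
    (z : Orbit S ι ε × VertexGroup ι S) : a.act ε (b.act ε z) = c.act ε z := by
  refine Prod.ext (move_mul h z.1).symm ?_
  simp only [Gen.act]
  rw [← mul_assoc]
  congr 1
  obtain ⟨h1, h2, h3⟩ := cocycle_mul h z.1
  exact gen_mul ⟨congrArg (shiftWord ι ε) h1, congrArg (shiftWord ι ε) h2, h3⟩

/-- The symbol `h(w; σ⁻¹)`. -/
def Gen.inv (a : Gen ι S) : Gen ι S where
  word := a.word
  perm := a.perm⁻¹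
  reduced := a.reduced
  mem := inv_mem a.mem
  fix := fun x hx => by rw [Equiv.Perm.inv_eq_iff_eq, a.fix x hx]

/-- The symbol `h(w; 1)`. -/
def Gen.one (a : Gen ι S) : Gen ι S where
  word := a.word
  perm := 1
  reduced := a.reduced
  mem := one_mem _
  fix := fun _ _ => rfl

theorem act_one {ε : ℤˣ} (a : Gen ι S) (z : Orbit S ι ε × VertexGroup ι S) :
    a.one.act ε z = z := by
  have hm : a.one.move z.1 = z.1 := by
    by_cases h : a.one.word = []
    · exact Subtype.ext (by rw [move_nil h]; rfl)
    · exact move_of_ne h _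
  have hp : (a.one.cocycle z.1).perm = 1 := by
    by_cases h : a.one.word = []
    · rw [cocycle_perm_nil h, hm]
      simp [Gen.one]
    · rw [cocycle_perm_of_ne h]
      rfl
  refine Prod.ext hm ?_
  simp only [Gen.act]
  rw [gen_eq_one (by exact hp), one_mul]

/-- `Gen.act` as a permutation. -/
noncomputable def Gen.actPerm (ε : ℤˣ) (a : Gen ι S) :
    Equiv.Perm (Orbit S ι ε × VertexGroup ι S) where
  toFun := a.act ε
  invFun := a.inv.act ε
  left_inv z := by
    exact (act_mul (a := a.inv) (b := a) (c := a.one) ⟨rfl, rfl, by simp [Gen.one, Gen.inv]⟩ z).trans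
      (act_one a z)
  right_inv z := by
    exact (act_mul (a := a) (b := a.inv) (c := a.one) ⟨rfl, rfl, by simp [Gen.one, Gen.inv]⟩ z).trans
      (act_one a z)

/-- The action of `G` on the product of the orbit of `ι_ε` and `G`, by means of which `θ^{-ε}` is
shown to be well defined. -/
noncomputable def actHom (ι : ∀ ε, I ε) (S : ∀ ε, Subgroup (Equiv.Perm (I ε))) (ε : ℤˣ) :
    VertexGroup ι S →* Equiv.Perm (Orbit S ι ε × VertexGroup ι S) :=
  PresentedGroup.toGroup (f := Gen.actPerm ε) (by
    rintro r ((⟨a, b, c, h, rfl⟩ | ⟨a, b, c, h, rfl⟩) | ⟨a, b, h, rfl⟩)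
    · simp only [map_mul, map_inv, FreeGroup.lift_apply_of]
      rw [mul_inv_eq_one]
      exact Equiv.ext fun z => act_mul h z
    · simp only [map_mul, map_inv, FreeGroup.lift_apply_of]
      rw [mul_inv_eq_one, mul_inv_eq_iff_eq_mul]
      refine Equiv.ext fun z => Prod.ext ?_ ?_
      · simp [Gen.actPerm, Gen.act, move_of_ne h.ne_nil.1, move_of_ne h.ne_nil.2]
      · simp only [Gen.actPerm, Gen.act, Equiv.Perm.mul_apply, Equiv.coe_fn_mk]
        rw [← mul_assoc, ← mul_assoc]
        congr 1
        have := shift_conj (cocycle_isEdge a z.1) (cocycle_isEdge b z.1)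
          (cocycle_isEdge c (a.move z.1)) (cocycle_conj h z.1)
        simpa only [move_of_ne h.ne_nil.1] using this
    · simp only [map_mul, map_inv, FreeGroup.lift_apply_of]
      rw [mul_inv_eq_one, mul_inv_eq_iff_eq_mul]
      refine Equiv.ext fun z => Prod.ext ?_ ?_
      · simp [Gen.actPerm, Gen.act, move_of_ne h.ne_nil.1, move_of_ne h.ne_nil.2]
      · simp only [Gen.actPerm, Gen.act, Equiv.Perm.mul_apply, Equiv.coe_fn_mk]
        rw [← mul_assoc, ← mul_assoc]
        congr 1
        have := shift_comm (cocycle_isEdge a z.1) (cocycle_isEdge b z.1) (cocycle_comm h z.1)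
        simpa only [move_of_ne h.ne_nil.1, move_of_ne h.ne_nil.2] using this)

theorem actHom_gen (ε : ℤˣ) {a : Gen ι S} (ha : a.IsEdge ε) (g : VertexGroup ι S) :
    actHom ι S ε (gen a) (orbitBase S ι ε, g) = (orbitBase S ι ε, gen (a.shift ε ha) * g) := by
  have h0 : actHom ι S ε (gen a) = a.actPerm ε := PresentedGroup.toGroup.of _
  have hm : a.move (orbitBase S ι ε) = orbitBase S ι ε := by
    by_cases h : a.word = []
    · exact Subtype.ext (by rw [move_nil h]; exact ha h)
    · exact move_of_ne h _
  have hc : a.cocycle (orbitBase S ι ε) = a := by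
    refine Gen.ext ?_ ?_
    · rw [cocycle_word, rep_base]
      cases a.word <;> simp [mapHead]
    · by_cases h : a.word = []
      · rw [cocycle_perm_nil h, hm, rep_base]
        simp
      · exact cocycle_perm_of_ne h _
  rw [h0]
  refine Prod.ext hm ?_
  simp only [Gen.actPerm, Gen.act, Equiv.coe_fn_mk, hc]

theorem gen_mem {ε : ℤˣ} {a : Gen ι S} (ha : a.IsEdge ε) : gen a ∈ edgeGroup ι S ε :=
  Subgroup.subset_closure ⟨a, ha, rfl⟩

theorem shift_isEdge {ε δ : ℤˣ} (hδ : -ε = δ) {a : Gen ι S} (ha : a.IsEdge ε) :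
    (a.shift ε ha).IsEdge δ := by
  subst hδ
  intro h
  have h' : shiftWord ι ε a.word = [] := h
  rcases hw : a.word with _ | ⟨x, w⟩
  · simp [hw, shiftWord] at h'
  · by_cases hx : x = base ι ε
    · subst hx
      rw [hw, shiftWord_base] at h'
      subst h'
      exact perm_base_neg (a := a) hw
    · simp [hw, shiftWord_cons hx] at h'

theorem actHom_edge (ε : ℤˣ) {g : VertexGroup ι S} (hg : g ∈ edgeGroup ι S ε) :
    ∃ k ∈ edgeGroup ι S (-ε), ∀ x, actHom ι S ε g (orbitBase S ι ε, x) =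
      (orbitBase S ι ε, k * x) := by
  induction hg using Subgroup.closure_induction with
  | mem g hg =>
    obtain ⟨a, ha, rfl⟩ := hg
    exact ⟨_, gen_mem (shift_isEdge rfl ha), actHom_gen ε ha⟩
  | one => exact ⟨1, one_mem _, fun x => by simp⟩
  | mul g g' _ _ h h' =>
    obtain ⟨k, hk, h⟩ := h
    obtain ⟨k', hk', h'⟩ := h'
    exact ⟨k * k', mul_mem hk hk', fun x => by
      rw [map_mul, Equiv.Perm.mul_apply, h', h, mul_assoc]⟩
  | inv g _ h =>
    obtain ⟨k, hk, h⟩ := h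
    exact ⟨k⁻¹, inv_mem hk, fun x => by
      rw [map_inv, Equiv.Perm.inv_eq_iff_eq, h, mul_inv_cancel_left]⟩

/-- `θ^{-ε} : H_ε → H_δ`, where `δ = -ε`, as a homomorphism. -/
noncomputable def thetaHom (ι : ∀ ε, I ε) (S : ∀ ε, Subgroup (Equiv.Perm (I ε))) (ε δ : ℤˣ)
    (hδ : -ε = δ) : edgeGroup ι S ε →* edgeGroup ι S δ where
  toFun g := ⟨(actHom ι S ε g (orbitBase S ι ε, 1)).2, by
    obtain ⟨k, hk, h⟩ := actHom_edge ε g.2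
    rw [h, mul_one, ← hδ]
    exact hk⟩
  map_one' := by simp
  map_mul' g g' := by
    obtain ⟨k, hk, h⟩ := actHom_edge ε g.2
    obtain ⟨k', hk', h'⟩ := actHom_edge ε g'.2
    refine Subtype.ext ?_
    simp [h, h']

theorem thetaHom_gen {ε δ : ℤˣ} (hδ : -ε = δ) {a : Gen ι S} (ha : a.IsEdge ε) :
    thetaHom ι S ε δ hδ ⟨gen a, gen_mem ha⟩ =
      ⟨gen (a.shift ε ha), gen_mem (shift_isEdge hδ ha)⟩ := by
  refine Subtype.ext ?_
  simp [thetaHom, actHom_gen ε ha]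

theorem shift_shift {ε δ : ℤˣ} (hδ : -ε = δ) {a : Gen ι S} (ha : a.IsEdge ε) :
    (a.shift ε ha).shift δ (shift_isEdge hδ ha) = a := by
  subst hδ
  refine Gen.ext ?_ rfl
  have h := a.reduced
  simp only [Gen.shift]
  rcases hw : a.word with _ | ⟨x, w⟩
  · simp [shiftWord]
  · by_cases hx : x = base ι ε
    · subst hx
      rw [shiftWord_base]
      rcases w with _ | ⟨y, w⟩
      · simp [shiftWord]
      · have hy : y ≠ base ι (-ε) := by
          rintro rfl
          exact not_reduced_base (hw ▸ h)
        rw [shiftWord_cons hy, neg_neg]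
    · rw [shiftWord_cons hx, shiftWord_base]

theorem thetaHom_thetaHom {ε δ : ℤˣ} (hδ : -ε = δ) (hε : -δ = ε) (g : edgeGroup ι S ε) :
    thetaHom ι S δ ε hε (thetaHom ι S ε δ hδ g) = g := by
  obtain ⟨g, hg⟩ := g
  induction hg using Subgroup.closure_induction with
  | mem g hg =>
    obtain ⟨a, ha, rfl⟩ := hg
    refine (congrArg _ (thetaHom_gen hδ ha)).trans ?_
    rw [thetaHom_gen hε (shift_isEdge hδ ha)]
    simp only [shift_shift hδ ha]
  | one => exact (congrArg _ (map_one _)).trans (map_one _)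
  | mul g g' hg hg' h h' =>
    have := congrArg₂ (· * ·) h h'
    simp only [← map_mul] at this
    exact this
  | inv g hg h =>
    have := congrArg (·⁻¹) h
    simp only [← map_inv] at this
    exact this

variable (ι S)

/-- The isomorphism `θ : H = H₋₁ → H₁`. -/
noncomputable def theta : edgeGroup ι S (-1) ≃* edgeGroup ι S 1 where
  toFun := thetaHom ι S (-1) 1 (neg_neg 1)
  invFun := thetaHom ι S 1 (-1) rfl
  left_inv := thetaHom_thetaHom _ _
  right_inv := thetaHom_thetaHom _ _
  map_mul' := map_mul _

/-- The values of `θ` on the generators of `H`. -/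
theorem theta_gen {a : Gen ι S} (ha : a.IsEdge (-1)) :
    theta ι S ⟨gen a, gen_mem ha⟩ =
      ⟨gen (a.shift (-1) ha), gen_mem (shift_isEdge (neg_neg 1) ha)⟩ :=
  thetaHom_gen (neg_neg 1) ha

/-- The group `Λ[Σ₋₁, Σ₁] = HNN(G, H, θ) = ⟨G, τ ∣ τ⁻¹ h τ = θ(h) for all h ∈ H⟩`. In Mathlib's
convention `t h t⁻¹ = θ(h)`, so the letter `τ` is `t⁻¹`. -/
abbrev HNNGroup : Type u :=
  HNNExtension (VertexGroup ι S) (edgeGroup ι S (-1)) (edgeGroup ι S 1) (theta ι S)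

end

end HNNFamily

namespace HNNFamily

universe u

open Filter Pointwise

/-! ### The action of `G` and of `Λ` on the admissible sequences -/

section Action

variable {I : ℤˣ → Type u} {ι : ∀ ε, I ε} {S : ∀ ε, Subgroup (Equiv.Perm (I ε))}

/-! `Λ` acts on its Bass–Serre tree, realised concretely. The vertices are the admissible sequences,
each joined to its extensions by one letter; `h(w; σ)` applies `σ` to the letter that follows `w`,
and the stable letter moves the root to a neighbour. The action is transitive on vertices
(`exists_smul_root_eq`), inverts no edge because edges carry an invariant sign, and has `G` as
stabilizer of the root (`exists_of_eq_of_smul_root`). It is faithful (`eq_one_of_forall_smul`): for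
`G` this is an induction on the length of the sequences in the symbols, in which `θ` removes a first
letter.

A non-trivial element that fixes a vertex is conjugate into `G`. An element of `G` is a finite
product of symbols, each altering the next letter at a single vertex, so only finitely many fixed
vertices have a moved neighbour; by faithfulness there is at least one
(`fixBoundary_finite_nonempty`). This finite set is transported by conjugation. An element without
fixed vertex translates along an axis: for a half-tree `Y`, its positive powers eventually move all
vertices to the same side, into `Y` or out of it (`eventually_mem_halfTree`).

Hence each non-trivial element leans towards `Y` or towards its complement, either through half of
its finite set or through its powers. No element leans towards three disjoint sets at once. As `Y`
has infinitely many disjoint translates, the elements leaning towards `Y` form a set with infinitely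
many conjugates of equal mean, no three with a common point, so its mean is zero. The same holds for
the complement of `Y`. The two sets cover everything, which contradicts total mean one
(`not_innerAmenable_of_action`). -/

open Classical in
/-- The map `w, x, v ↦ w, σ(x), v`, which fixes the sequences that do not properly extend `w`. -/
noncomputable def permAt (σ : Equiv.Perm (Letter I)) :
    List (Letter I) → List (Letter I) → List (Letter I)
  | [], v => mapHead σ v
  | _ :: _, [] => []
  | x :: w, y :: v => if x = y then y :: permAt σ w v else y :: v

theorem permAt_nil_left (σ : Equiv.Perm (Letter I)) (v : List (Letter I)) :
    permAt σ [] v = mapHead σ v := by simp [permAt]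

theorem permAt_nil_right (σ : Equiv.Perm (Letter I)) (w : List (Letter I)) :
    permAt σ w [] = [] := by cases w <;> simp [permAt, mapHead]

theorem permAt_cons_self (σ : Equiv.Perm (Letter I)) (x : Letter I) (w v : List (Letter I)) :
    permAt σ (x :: w) (x :: v) = x :: permAt σ w v := by simp [permAt]

theorem permAt_cons_of_ne (σ : Equiv.Perm (Letter I)) {x y : Letter I} (h : x ≠ y)
    (w v : List (Letter I)) : permAt σ (x :: w) (y :: v) = y :: v := by simp [permAt, h]

theorem permAt_append (σ : Equiv.Perm (Letter I)) (w v : List (Letter I)) :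
    permAt σ w (w ++ v) = w ++ mapHead σ v := by
  induction w with
  | nil => simp [permAt_nil_left]
  | cons x w ih => simp [permAt_cons_self, ih]

theorem permAt_of_not_prefix (σ : Equiv.Perm (Letter I)) {w v : List (Letter I)}
    (h : ¬ w <+: v) : permAt σ w v = v := by
  induction w generalizing v with
  | nil => exact absurd List.nil_prefix h
  | cons x w ih =>
    rcases v with _ | ⟨y, v⟩
    · exact permAt_nil_right _ _
    · by_cases hxy : x = y
      · subst hxy
        rw [permAt_cons_self, ih fun h' => h (List.cons_prefix_cons.2 ⟨rfl, h'⟩)]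
      · exact permAt_cons_of_ne _ hxy _ _

theorem mapHead_mul (σ τ : Equiv.Perm (Letter I)) (v : List (Letter I)) :
    mapHead (σ * τ) v = mapHead σ (mapHead τ v) := by cases v <;> simp [mapHead]

theorem mapHead_one (v : List (Letter I)) : mapHead 1 v = v := by cases v <;> simp [mapHead]

theorem permAt_mul (σ τ : Equiv.Perm (Letter I)) (w v : List (Letter I)) :
    permAt (σ * τ) w v = permAt σ w (permAt τ w v) := by
  by_cases h : w <+: v
  · obtain ⟨v, rfl⟩ := h
    simp only [permAt_append, mapHead_mul]
  · simp only [permAt_of_not_prefix _ h]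

theorem permAt_one (w v : List (Letter I)) : permAt 1 w v = v := by
  by_cases h : w <+: v
  · obtain ⟨v, rfl⟩ := h
    simp only [permAt_append, mapHead_one]
  · exact permAt_of_not_prefix _ h

theorem prefix_permAt_iff (σ : Equiv.Perm (Letter I)) (w v : List (Letter I)) :
    w <+: permAt σ w v ↔ w <+: v := by
  by_cases h : w <+: v
  · obtain ⟨v, rfl⟩ := h
    simp [permAt_append]
  · simp only [permAt_of_not_prefix _ h]

theorem permAt_conj (σ ρ : Equiv.Perm (Letter I)) (w : List (Letter I)) (x : Letter I)
    (v y : List (Letter I)) :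
    permAt σ w (permAt ρ (w ++ x :: v) y) = permAt ρ (w ++ σ x :: v) (permAt σ w y) := by
  induction w generalizing y with
  | nil =>
    rcases y with _ | ⟨z, y⟩
    · simp [permAt_nil_right]
    · by_cases h : x = z
      · subst h
        simp [permAt_nil_left, permAt_cons_self, mapHead]
      · simp [permAt_nil_left, permAt_cons_of_ne, mapHead, h]
  | cons z w ih =>
    rcases y with _ | ⟨z', y⟩
    · simp [permAt_nil_right]
    · by_cases h : z = z'
      · subst h
        simp [permAt_cons_self, ih]
      · simp [permAt_cons_of_ne, h]

/-- Under these hypotheses `w` and `v` have no common extension, so the two maps are supported on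
disjoint invariant sets. -/
theorem permAt_comm (σ ρ : Equiv.Perm (Letter I)) {w v : List (Letter I)}
    (h1 : w.length ≤ v.length) (h2 : ¬ w <+: v) (y : List (Letter I)) :
    permAt σ w (permAt ρ v y) = permAt ρ v (permAt σ w y) := by
  have key : ∀ y, w <+: y → ¬ v <+: y := fun y hw hv =>
    h2 (List.prefix_of_prefix_length_le hw hv h1)
  by_cases hw : w <+: y
  · rw [permAt_of_not_prefix ρ (key y hw),
      permAt_of_not_prefix ρ (key _ ((prefix_permAt_iff σ w y).2 hw))]
  · rw [permAt_of_not_prefix σ hw, permAt_of_not_prefix σ]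
    intro h
    by_cases hv : v <+: y
    · exact key _ h ((prefix_permAt_iff ρ v y).2 hv)
    · rw [permAt_of_not_prefix ρ hv] at h
      exact hw h

/-- The permutation of a symbol fixes the one letter that is forbidden after its sequence, so an
allowed letter stays allowed. This is the purpose of the condition `σ ∈ Γ_w`. -/
theorem isReduced_permAt (a : Gen ι S) {v : List (Letter I)} (hv : IsReduced ι v) :
    IsReduced ι (permAt a.perm a.word v) := by
  by_cases h : a.word <+: v
  · obtain ⟨v, rfl⟩ := h
    rw [permAt_append]
    have hm := isReduced_mapHead (S := S) (ι := ι) a.mem (w := v)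
    rw [isReduced_iff, List.isChain_append] at hv ⊢
    rw [isReduced_iff, isReduced_iff] at hm
    refine ⟨hv.1, hm hv.2.1, fun x hx y hy => ?_⟩
    rcases v with _ | ⟨z, v⟩
    · simp [mapHead] at hy
    · have hz := hv.2.2 x hx z (by simp)
      simp only [mapHead, List.head?_cons, Option.mem_def, Option.some.injEq] at hy
      rw [← hy, ← a.fix x hx]
      exact fun h => hz (a.perm.injective h)
  · rwa [permAt_of_not_prefix _ h]

variable (ι) in
/-- The vertices of the tree on which the groups act: the admissible sequences. -/
abbrev Vertex : Type u := {w : List (Letter I) // IsReduced ι w}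

/-- The empty sequence. -/
def root : Vertex ι := ⟨[], isReduced_nil⟩

/-- The sequence that consists of one letter. -/
def single (x : Letter I) : Vertex ι := ⟨[x], isReduced_singleton x⟩

/-- The action of a generator of `G` on the vertices. -/
noncomputable def Gen.vertexPerm (a : Gen ι S) : Equiv.Perm (Vertex ι) where
  toFun v := ⟨permAt a.perm a.word v, isReduced_permAt a v.2⟩
  invFun v := ⟨permAt a.inv.perm a.inv.word v, isReduced_permAt a.inv v.2⟩
  left_inv v := Subtype.ext (by simp [Gen.inv, ← permAt_mul, permAt_one])
  right_inv v := Subtype.ext (by simp [Gen.inv, ← permAt_mul, permAt_one])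

theorem Gen.coe_vertexPerm (a : Gen ι S) (v : Vertex ι) :
    (a.vertexPerm v : List (Letter I)) = permAt a.perm a.word v := rfl

variable (ι S) in
/-- The action of `G` on the vertices. -/
noncomputable def vertexHom : VertexGroup ι S →* Equiv.Perm (Vertex ι) :=
  PresentedGroup.toGroup (f := Gen.vertexPerm) (by
    rintro r ((⟨a, b, c, h, rfl⟩ | ⟨a, b, c, h, rfl⟩) | ⟨a, b, h, rfl⟩)
    · simp only [map_mul, map_inv, FreeGroup.lift_apply_of]
      rw [mul_inv_eq_one]
      refine Equiv.ext fun v => Subtype.ext ?_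
      obtain ⟨h1, h2, h3⟩ := h
      simp [Gen.coe_vertexPerm, h1, h2, h3, permAt_mul]
    · simp only [map_mul, map_inv, FreeGroup.lift_apply_of]
      rw [mul_inv_eq_one, mul_inv_eq_iff_eq_mul]
      refine Equiv.ext fun v => Subtype.ext ?_
      obtain ⟨x, w, h1, h2, h3⟩ := h
      simp [Gen.coe_vertexPerm, h1, h2, h3, permAt_conj]
    · simp only [map_mul, map_inv, FreeGroup.lift_apply_of]
      rw [mul_inv_eq_one, mul_inv_eq_iff_eq_mul]
      refine Equiv.ext fun v => Subtype.ext ?_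
      simp [Gen.coe_vertexPerm, permAt_comm _ _ h.1 h.2])

theorem coe_vertexHom_gen (a : Gen ι S) (v : Vertex ι) :
    (vertexHom ι S (gen a) v : List (Letter I)) = permAt a.perm a.word v := by
  have h0 : vertexHom ι S (gen a) = a.vertexPerm := PresentedGroup.toGroup.of _
  rw [h0]
  rfl

theorem shiftWord_shiftWord {ε δ : ℤˣ} (h : -ε = δ) {v : List (Letter I)} (hv : IsReduced ι v) :
    shiftWord ι δ (shiftWord ι ε v) = v := by
  subst h
  rcases v with _ | ⟨x, v⟩
  · simp [shiftWord]
  · by_cases hx : x = base ι ε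
    · subst hx
      rw [shiftWord_base]
      rcases v with _ | ⟨y, v⟩
      · simp [shiftWord]
      · have hy : y ≠ base ι (-ε) := by
          rintro rfl
          exact not_reduced_base hv
        rw [shiftWord_cons hy, neg_neg]
    · rw [shiftWord_cons hx, shiftWord_base]

variable (ι) in
/-- `shiftWord` as a permutation of the vertices. -/
noncomputable def shiftPerm (ε : ℤˣ) : Equiv.Perm (Vertex ι) where
  toFun v := ⟨shiftWord ι ε v, isReduced_shiftWord ε v.2⟩
  invFun v := ⟨shiftWord ι (-ε) v, isReduced_shiftWord (-ε) v.2⟩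
  left_inv v := Subtype.ext (shiftWord_shiftWord rfl v.2)
  right_inv v := Subtype.ext (shiftWord_shiftWord (neg_neg ε) v.2)

theorem coe_shiftPerm (ε : ℤˣ) (v : Vertex ι) :
    (shiftPerm ι ε v : List (Letter I)) = shiftWord ι ε v := rfl

theorem shiftPerm_neg (ε : ℤˣ) : shiftPerm ι (-ε) = (shiftPerm ι ε)⁻¹ := by
  rw [eq_inv_iff_mul_eq_one]
  exact Equiv.ext fun v => Subtype.ext (shiftWord_shiftWord rfl v.2)

/-- This gives the relation of the stable letter on the tree. The shift renames the vertices as seen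
from the other end of the edge between the root and `(ι_ε, -ε)`; a symbol of `H_ε` fixes that edge,
and its new name is its image under `θ^{-ε}`. -/
theorem permAt_shift {ε : ℤˣ} (a : Gen ι S) (ha : a.IsEdge ε) {v : List (Letter I)}
    (hv : IsReduced ι v) :
    shiftWord ι ε (permAt a.perm a.word v) =
      permAt a.perm (shiftWord ι ε a.word) (shiftWord ι ε v) := by
  have head_ne : ∀ {δ : ℤˣ} {y : Letter I} {u : List (Letter I)},
      IsReduced ι (base ι δ :: y :: u) → y ≠ base ι (-δ) := by
    rintro δ y u h rfl
    exact not_reduced_base h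
  rcases hw : a.word with _ | ⟨x, w⟩
  · have hfix := ha hw
    rw [permAt_nil_left]
    rcases v with _ | ⟨z, v⟩
    · simp [shiftWord, mapHead, permAt_cons_self, permAt_nil_right]
    · by_cases hz : z = base ι ε
      · subst hz
        simp only [mapHead, hfix, shiftWord_base]
        rcases v with _ | ⟨y, v⟩
        · rw [permAt_nil_right]
        · simp only [shiftWord]
          rw [permAt_cons_of_ne _ (head_ne hv).symm]
      · have hz' : a.perm z ≠ base ι ε := fun h => hz (a.perm.injective (h.trans hfix.symm))
        simp only [mapHead, shiftWord_cons hz, shiftWord_cons hz']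
        simp [shiftWord, permAt_cons_self, permAt_nil_left, mapHead]
  · by_cases hx : x = base ι ε
    · subst hx
      -- For empty `w` the permutation fixes `ι_{-ε}` by the condition on symbols; otherwise `w`,
      -- which follows `ι_ε` in an admissible sequence, begins with another letter.
      have key : ∀ r, permAt a.perm w (base ι (-ε) :: r) = base ι (-ε) :: r := by
        intro r
        rcases w with _ | ⟨y, w⟩
        · rw [permAt_nil_left, mapHead, perm_base_neg hw]
        · exact permAt_cons_of_ne _ (head_ne (hw ▸ a.reduced)) _ _
      rw [shiftWord_base]
      rcases v with _ | ⟨z, v⟩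
      · simp only [permAt_nil_right, shiftWord, key]
      · by_cases hz : z = base ι ε
        · subst hz
          rw [permAt_cons_self, shiftWord_base, shiftWord_base]
        · rw [permAt_cons_of_ne _ (Ne.symm hz), shiftWord_cons hz, key]
    · rw [shiftWord_cons hx]
      rcases v with _ | ⟨z, v⟩
      · simp only [permAt_nil_right, shiftWord, permAt_cons_self]
      · by_cases hz : z = base ι ε
        · subst hz
          rw [permAt_cons_of_ne _ hx, shiftWord_base]
          rcases v with _ | ⟨y, v⟩
          · rw [permAt_nil_right]
          · rw [permAt_cons_of_ne _ (head_ne hv).symm]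
        · rw [shiftWord_cons hz, permAt_cons_self]
          by_cases hxz : x = z
          · subst hxz
            rw [permAt_cons_self, shiftWord_cons hx]
          · rw [permAt_cons_of_ne _ hxz, shiftWord_cons hz]

theorem shiftPerm_mul_vertexHom {ε δ : ℤˣ} (hδ : -ε = δ) (g : edgeGroup ι S ε) :
    shiftPerm ι ε * vertexHom ι S g =
      vertexHom ι S (thetaHom ι S ε δ hδ g) * shiftPerm ι ε := by
  obtain ⟨g, hg⟩ := g
  induction hg using Subgroup.closure_induction with
  | mem g hg =>
    obtain ⟨a, ha, rfl⟩ := hg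
    have := thetaHom_gen hδ ha
    rw [this]
    refine Equiv.ext fun v => Subtype.ext ?_
    simp only [Equiv.Perm.mul_apply, coe_shiftPerm, coe_vertexHom_gen]
    exact permAt_shift a ha v.2
  | one =>
    have : thetaHom ι S ε δ hδ ⟨1, one_mem _⟩ = 1 := map_one _
    rw [this]
    simp
  | mul g g' hg hg' h h' =>
    have : thetaHom ι S ε δ hδ ⟨g * g', mul_mem hg hg'⟩ =
      thetaHom ι S ε δ hδ ⟨g, hg⟩ * thetaHom ι S ε δ hδ ⟨g', hg'⟩ := map_mul _ (⟨g, hg⟩ : edgeGroup ι S ε) ⟨g', hg'⟩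
    rw [this, Subgroup.coe_mul, map_mul, map_mul, ← mul_assoc, h, mul_assoc, h', mul_assoc]
  | inv g hg h =>
    have : thetaHom ι S ε δ hδ ⟨g⁻¹, inv_mem hg⟩ = (thetaHom ι S ε δ hδ ⟨g, hg⟩)⁻¹ :=
      map_inv _ (⟨g, hg⟩ : edgeGroup ι S ε)
    rw [this, Subgroup.coe_inv, map_inv, map_inv, mul_inv_eq_iff_eq_mul, mul_assoc,
      eq_inv_mul_iff_mul_eq]
    exact h.symm

theorem shiftPerm_mul_vertexHom_theta (a : edgeGroup ι S (-1)) :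
    shiftPerm ι (-1) * vertexHom ι S a = vertexHom ι S (theta ι S a) * shiftPerm ι (-1) :=
  shiftPerm_mul_vertexHom (neg_neg 1) a

variable (ι S) in
/-- The action of `Λ` on the vertices. -/
noncomputable def treeHom : HNNGroup ι S →* Equiv.Perm (Vertex ι) :=
  HNNExtension.lift (vertexHom ι S) (shiftPerm ι (-1)) shiftPerm_mul_vertexHom_theta

noncomputable instance : MulAction (HNNGroup ι S) (Vertex ι) :=
  MulAction.compHom _ (treeHom ι S)

theorem smul_eq_treeHom (g : HNNGroup ι S) (v : Vertex ι) : g • v = treeHom ι S g v := rfl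

theorem of_smul (g : VertexGroup ι S) (v : Vertex ι) :
    (HNNExtension.of g : HNNGroup ι S) • v = vertexHom ι S g v := by
  rw [smul_eq_treeHom, treeHom, HNNExtension.lift_of]

theorem coe_t_zpow_smul (u : ℤˣ) (v : Vertex ι) :
    (((HNNExtension.t : HNNGroup ι S) ^ (u : ℤ) • v : Vertex ι) : List (Letter I)) =
      shiftWord ι (-u) v := by
  rw [smul_eq_treeHom, map_zpow, treeHom, HNNExtension.lift_t]
  rcases Int.units_eq_one_or u with rfl | rfl
  · simp [coe_shiftPerm]
  · rw [Units.val_neg, Units.val_one, zpow_neg, zpow_one, ← shiftPerm_neg, coe_shiftPerm]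

end Action

/-! ### Faithfulness of the action of `G` -/

section Faithful

variable {I : ℤˣ → Type u} {ι : ∀ ε, I ε} {S : ∀ ε, Subgroup (Equiv.Perm (I ε))}

theorem gen_inv (a : Gen ι S) : gen a.inv = (gen a)⁻¹ := by
  have h : gen a * gen a.inv = gen a.one :=
    gen_mul (c := a.one) ⟨rfl, rfl, by simp [Gen.one, Gen.inv]⟩
  rw [gen_eq_one (a := a.one) rfl] at h
  exact eq_inv_of_mul_eq_one_right h

variable (ι S) in
/-- The subgroup of `G` generated by the `h(w; σ)` for which `w` has the property `P`. -/
def wordGroup (P : List (Letter I) → Prop) : Subgroup (VertexGroup ι S) :=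
  Subgroup.closure {g | ∃ a : Gen ι S, P a.word ∧ gen a = g}

theorem gen_mem_wordGroup {P : List (Letter I) → Prop} {a : Gen ι S} (h : P a.word) :
    gen a ∈ wordGroup ι S P := Subgroup.subset_closure ⟨a, h, rfl⟩

theorem wordGroup_mono {P Q : List (Letter I) → Prop} (h : ∀ w, P w → Q w) :
    wordGroup ι S P ≤ wordGroup ι S Q :=
  Subgroup.closure_mono fun _ ⟨a, ha, hg⟩ => ⟨a, h _ ha, hg⟩

-- The inverse of a symbol is a symbol with the same sequence, so multiplication by symbols from the
-- left suffices.
@[elab_as_elim]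
theorem wordGroup_induction {P : List (Letter I) → Prop}
    {motive : ∀ g : VertexGroup ι S, g ∈ wordGroup ι S P → Prop} (one : motive 1 (one_mem _))
    (mul : ∀ (a : Gen ι S) (g : VertexGroup ι S) (ha : P a.word) (hg : g ∈ wordGroup ι S P),
      motive g hg → motive (gen a * g) (mul_mem (gen_mem_wordGroup ha) hg))
    {g : VertexGroup ι S} (hg : g ∈ wordGroup ι S P) : motive g hg := by
  induction hg using Subgroup.closure_induction_left with
  | one => exact one
  | mul_left x hx y hy h =>
    obtain ⟨a, ha, rfl⟩ := hx
    exact mul a y ha hy h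
  | inv_mul_cancel x hx y hy h =>
    obtain ⟨a, ha, rfl⟩ := hx
    simp only [← gen_inv]
    exact mul a.inv y ha hy h

theorem mem_wordGroup_true (g : VertexGroup ι S) : g ∈ wordGroup ι S fun _ => True := by
  have h : (Subgroup.closure (Set.range PresentedGroup.of) : Subgroup (VertexGroup ι S)) ≤
      wordGroup ι S fun _ => True :=
    Subgroup.closure_mono (by rintro _ ⟨a, rfl⟩; exact ⟨a, trivial, rfl⟩)
  rw [PresentedGroup.closure_range_of] at h
  exact h (Subgroup.mem_top g)

theorem vertexHom_eq_self {P : List (Letter I) → Prop} {v : Vertex ι}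
    (h : ∀ w, P w → ∀ σ, permAt σ w v.1 = v.1) {g : VertexGroup ι S}
    (hg : g ∈ wordGroup ι S P) : vertexHom ι S g v = v := by
  induction hg using wordGroup_induction with
  | one => simp
  | mul a g ha _ ih =>
    rw [map_mul, Equiv.Perm.mul_apply, ih]
    exact Subtype.ext ((coe_vertexHom_gen a v).trans (h _ ha _))

variable (ι S) in
/-- The subgroup of `G` generated by the `h(w; σ)` with `w` of length at most `n`. -/
abbrev depthGroup (n : ℕ) : Subgroup (VertexGroup ι S) := wordGroup ι S fun w => w.length ≤ n

variable (ι S) in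
/-- The subgroup of `G` generated by the `h(w; σ)` with `w` of length at most `n` and with a
first letter that belongs to `F`. -/
abbrev headGroup (n : ℕ) (F : Set (Letter I)) : Subgroup (VertexGroup ι S) :=
  wordGroup ι S fun w => w.length ≤ n ∧ ∃ x ∈ F, ∃ v, w = x :: v

theorem exists_mem_depthGroup (g : VertexGroup ι S) : ∃ n, g ∈ depthGroup ι S n := by
  induction mem_wordGroup_true g using wordGroup_induction with
  | one => exact ⟨0, one_mem _⟩
  | mul a g _ _ ih =>
    obtain ⟨n, hn⟩ := ih
    exact ⟨max a.word.length n, mul_mem (gen_mem_wordGroup (le_max_left _ _))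
      (wordGroup_mono (fun w hw => hw.trans (le_max_right _ _)) hn)⟩

/-- The symbol `h(σ)`. -/
def rootGen (σ : Equiv.Perm (Letter I)) (hσ : σ ∈ prodGroup S) : Gen ι S where
  word := []
  perm := σ
  reduced := isReduced_nil
  mem := hσ
  fix := by simp

theorem gen_mul_rootGen {a : Gen ι S} (b : Gen ι S) (ha : a.word = []) :
    gen b * gen a = gen a * gen (b.translate a.perm⁻¹ (inv_mem a.mem)) ∨ b.word = [] := by
  rcases hb : b.word with _ | ⟨x, v⟩
  · exact Or.inr rfl
  · refine Or.inl (gen_conj (a := a)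
      (b := b.translate a.perm⁻¹ (inv_mem a.mem)) (c := b) ⟨a.perm⁻¹ x, v, ?_, ?_, rfl⟩).symm
    · simp [Gen.translate, mapHead, ha, hb]
    · simp [ha, hb]

/-- The symbols `h(σ)` can be collected on the left, since passing one of them only changes the
first letter of another symbol. The set `F` records the finitely many first letters that remain. -/
theorem exists_eq_gen_mul {n : ℕ} {g : VertexGroup ι S} (hg : g ∈ depthGroup ι S n) :
    ∃ a : Gen ι S, a.word = [] ∧ ∃ F : Set (Letter I), F.Finite ∧
      ∃ k ∈ headGroup ι S n F, g = gen a * k := by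
  induction hg using wordGroup_induction with
  | one =>
    exact ⟨rootGen 1 (one_mem _), rfl, ∅, Set.finite_empty, 1, one_mem _, by
      rw [gen_eq_one rfl, one_mul]⟩
  | mul b g hb _ ih =>
    obtain ⟨a, ha, F, hF, k, hk, rfl⟩ := ih
    rcases hw : b.word with _ | ⟨x, v⟩
    · refine ⟨rootGen (b.perm * a.perm) (mul_mem b.mem a.mem), rfl, F, hF, k, hk, ?_⟩
      rw [← mul_assoc]
      congr 1
      exact gen_mul ⟨hw, ha, rfl⟩
    · refine ⟨a, ha, insert (a.perm⁻¹ x) F, hF.insert _,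
        gen (b.translate a.perm⁻¹ (inv_mem a.mem)) * k, mul_mem (gen_mem_wordGroup ?_)
          (wordGroup_mono ?_ hk), ?_⟩
      · refine ⟨?_, a.perm⁻¹ x, Set.mem_insert _ _, v, by simp [Gen.translate, hw, mapHead]⟩
        rw [hw] at hb
        simpa [Gen.translate, hw, mapHead] using hb
      · rintro w ⟨h1, y, hy, h2⟩
        exact ⟨h1, y, Set.mem_insert_of_mem _ hy, h2⟩
      · rw [← mul_assoc, ← mul_assoc]
        congr 1
        exact (gen_mul_rootGen b ha).resolve_right (by simp [hw])

theorem vertexHom_single {n : ℕ} {F : Set (Letter I)} {k : VertexGroup ι S}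
    (hk : k ∈ headGroup ι S n F) (x : Letter I) :
    vertexHom ι S k (single x) = single x := by
  refine vertexHom_eq_self ?_ hk
  rintro _ ⟨-, y, -, v, rfl⟩ σ
  by_cases h : y = x
  · subst h
    rw [single, permAt_cons_self, permAt_nil_right]
  · exact permAt_cons_of_ne _ h _ _

theorem vertexHom_eq_self_of_head {n : ℕ} {F : Set (Letter I)} {k : VertexGroup ι S}
    (hk : k ∈ headGroup ι S n F) {v : Vertex ι} (hv : ∀ x ∈ F, ∀ u, v.1 ≠ x :: u) :
    vertexHom ι S k v = v := by
  refine vertexHom_eq_self ?_ hk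
  rintro _ ⟨-, y, hy, u, rfl⟩ σ
  rcases hv' : v.1 with _ | ⟨z, r⟩
  · exact permAt_nil_right _ _
  · refine permAt_cons_of_ne _ ?_ _ _
    rintro rfl
    exact hv _ hy _ hv'

theorem vertexHom_rootGen_single {a : Gen ι S} (ha : a.word = []) (x : Letter I) :
    vertexHom ι S (gen a) (single x) = single (a.perm x) :=
  Subtype.ext (by rw [coe_vertexHom_gen, ha, permAt_nil_left]; rfl)

theorem single_injective : Function.Injective (single : Letter I → Vertex ι) := fun x y h => by
  simpa [single] using h

/-- The stabilizer in `G` of the vertex `(ι_ε, -ε)` is `H_ε`. -/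
theorem mem_edgeGroup_of_fix {ε : ℤˣ} {g : VertexGroup ι S}
    (h : vertexHom ι S g (single (base ι ε)) = single (base ι ε)) : g ∈ edgeGroup ι S ε := by
  obtain ⟨n, hn⟩ := exists_mem_depthGroup g
  obtain ⟨a, ha, F, -, k, hk, rfl⟩ := exists_eq_gen_mul hn
  rw [map_mul, Equiv.Perm.mul_apply, vertexHom_single hk, vertexHom_rootGen_single ha] at h
  refine mul_mem (gen_mem fun _ => single_injective h) ?_
  refine Subgroup.closure_mono ?_ hk
  rintro _ ⟨b, ⟨-, x, -, v, hb⟩, rfl⟩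
  exact ⟨b, fun h0 => by simp [hb] at h0, rfl⟩

/-- Sequences with different first letters are incomparable, so their symbols commute and those
beginning with `x` can be moved to the left. -/
theorem exists_eq_mul_of_mem_headGroup {n : ℕ} {F : Set (Letter I)} {x : Letter I} (hx : x ∉ F)
    {g : VertexGroup ι S} (hg : g ∈ headGroup ι S n (insert x F)) :
    ∃ p ∈ headGroup ι S n {x}, ∃ q ∈ headGroup ι S n F, g = p * q := by
  induction hg using wordGroup_induction with
  | one => exact ⟨1, one_mem _, 1, one_mem _, by simp⟩
  | mul b g hb hg' ih =>
    obtain ⟨p, hp, q, hq, rfl⟩ := ih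
    obtain ⟨hn, y, hy, v, hv⟩ := hb
    by_cases hxy : y = x
    · exact ⟨gen b * p, mul_mem (gen_mem_wordGroup ⟨hn, y, hxy, v, hv⟩) hp, q, hq,
        (mul_assoc _ _ _).symm⟩
    · refine ⟨p, hp, gen b * q, mul_mem (gen_mem_wordGroup
        ⟨hn, y, Set.mem_of_mem_insert_of_ne hy hxy, v, hv⟩) hq, ?_⟩
      rw [← mul_assoc, ← mul_assoc]
      congr 1
      clear hq hg'
      induction hp using wordGroup_induction with
      | one => simp
      | mul c p hc _ ih =>
        obtain ⟨-, z, rfl, u, hu⟩ := hc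
        rw [← mul_assoc, mul_assoc _ p, ← ih, ← mul_assoc]
        congr 1
        refine gen_comm_of_incomp ?_ ?_
        · rw [hv, hu, List.cons_prefix_cons]
          exact fun h => hxy h.1
        · rw [hv, hu, List.cons_prefix_cons]
          exact fun h => hxy h.1.symm

theorem thetaHom_injective {ε δ : ℤˣ} (hδ : -ε = δ) :
    Function.Injective (thetaHom ι S ε δ hδ) :=
  Function.LeftInverse.injective (thetaHom_thetaHom hδ (by rw [← hδ, neg_neg]))

/-- The induction step on the depth: `θ^{-ε}` deletes the common first letter of all symbols
involved. -/
theorem headGroup_base_le {n : ℕ} (ε : ℤˣ) {p : VertexGroup ι S}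
    (hp : p ∈ headGroup ι S (n + 1) {base ι ε}) :
    ∃ h : p ∈ edgeGroup ι S ε,
      (thetaHom ι S ε (-ε) rfl ⟨p, h⟩ : VertexGroup ι S) ∈ depthGroup ι S n := by
  induction hp using wordGroup_induction with
  | one =>
    refine ⟨one_mem _, ?_⟩
    have : thetaHom ι S ε (-ε) rfl ⟨1, one_mem _⟩ = 1 := map_one _
    rw [this]
    exact one_mem _
  | mul a p ha _ ih =>
    obtain ⟨hl, x, rfl, v, hv⟩ := ha
    obtain ⟨h, ih⟩ := ih
    have hE : a.IsEdge ε := fun h0 => by simp [hv] at h0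
    refine ⟨mul_mem (gen_mem hE) h, ?_⟩
    have : thetaHom ι S ε (-ε) rfl ⟨gen a * p, mul_mem (gen_mem hE) h⟩ =
      thetaHom ι S ε (-ε) rfl ⟨gen a, gen_mem hE⟩ * thetaHom ι S ε (-ε) rfl ⟨p, h⟩ :=
      map_mul _ (⟨gen a, gen_mem hE⟩ : edgeGroup ι S ε) ⟨p, h⟩
    rw [this, thetaHom_gen rfl hE]
    refine mul_mem (gen_mem_wordGroup ?_) ih
    rw [hv] at hl
    simpa [Gen.shift, hv, shiftWord_base] using hl

/-- The shift conjugates the action of `p` to that of its image under `θ^{-ε}`, which has smaller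
depth, and `θ^{-ε}` is injective. -/
theorem eq_one_of_mem_headGroup_base {n : ℕ} {ε : ℤˣ}
    (ih : ∀ g ∈ depthGroup ι S n, vertexHom ι S g = 1 → g = 1)
    {p : VertexGroup ι S} (hp : p ∈ headGroup ι S (n + 1) {base ι ε})
    (h1 : vertexHom ι S p = 1) : p = 1 := by
  obtain ⟨h, hθ⟩ := headGroup_base_le ε hp
  have h2 := shiftPerm_mul_vertexHom (δ := -ε) rfl ⟨p, h⟩
  simp only [h1, mul_one] at h2
  have h3 := ih _ hθ (by simpa using h2.symm)
  have h4 : (⟨p, h⟩ : edgeGroup ι S ε) = 1 :=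
    thetaHom_injective (δ := -ε) rfl (Subtype.ext (by rw [h3, map_one]; rfl))
  exact congrArg Subtype.val h4

/-- Together with transitivity this reduces an arbitrary first letter to a base point. -/
theorem conj_mem_headGroup {n : ℕ} {a : Gen ι S} (ha : a.word = []) {x : Letter I}
    {p : VertexGroup ι S} (hp : p ∈ headGroup ι S n {x}) :
    (gen a)⁻¹ * p * gen a ∈ headGroup ι S n {a.perm⁻¹ x} := by
  induction hp using wordGroup_induction with
  | one => simp [one_mem]
  | mul b p hb _ ih =>
    obtain ⟨hl, y, rfl, v, hv⟩ := hb
    have h := (gen_mul_rootGen b ha).resolve_right (by simp [hv])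
    have : (gen a)⁻¹ * (gen b * p) * gen a =
        gen (b.translate a.perm⁻¹ (inv_mem a.mem)) * ((gen a)⁻¹ * p * gen a) := by
      rw [← mul_assoc, ← mul_assoc, ← mul_assoc, eq_inv_mul_of_mul_eq h.symm]
      simp only [mul_assoc, mul_inv_cancel_left]
    rw [this]
    refine mul_mem (gen_mem_wordGroup ⟨?_, _, rfl, v, by simp [Gen.translate, hv, mapHead]⟩) ih
    rw [hv] at hl
    simpa [Gen.translate, hv, mapHead] using hl

/-- Transitivity of `Γ` on `I_ε`. -/
theorem exists_perm_base (hS : ∀ ε, ∀ i j : I ε, ∃ σ ∈ S ε, σ i = j) (x : Letter I) :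
    ∃ σ ∈ prodGroup S, σ (base ι x.1) = x := by
  classical
  obtain ⟨σ, hσ, h⟩ := hS x.1 (ι x.1) x.2
  refine ⟨_, ⟨Function.update 1 x.1 σ, ?_, rfl⟩, ?_⟩
  · intro ε _
    by_cases hε : ε = x.1
    · subst hε
      simpa using hσ
    · simp [Function.update_of_ne hε, one_mem]
  · simp [base, Equiv.Perm.sigmaCongrRightHom, h]

/-- Induction on `F`: split `g = p * q` by first letters. Since `p` moves only sequences beginning
with `x` and `q` fixes all of these, triviality of the product forces `p` to act trivially;
conjugating `x` to a base point then gives `p = 1`. -/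
theorem eq_one_of_mem_headGroup (hS : ∀ ε, ∀ i j : I ε, ∃ σ ∈ S ε, σ i = j) {n : ℕ}
    (ih : ∀ g ∈ depthGroup ι S n, vertexHom ι S g = 1 → g = 1) {F : Set (Letter I)}
    (hF : F.Finite) {g : VertexGroup ι S} (hg : g ∈ headGroup ι S (n + 1) F)
    (h1 : vertexHom ι S g = 1) : g = 1 := by
  induction F, hF using Set.Finite.induction_on generalizing g with
  | empty =>
    induction hg using wordGroup_induction with
    | one => rfl
    | mul a g ha => simp at ha
  | @insert x F hx _ ihF =>
    obtain ⟨p, hp, q, hq, rfl⟩ := exists_eq_mul_of_mem_headGroup hx hg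
    have hp1 : vertexHom ι S p = 1 := by
      ext1 v
      by_cases hv : ∃ u, v.1 = x :: u
      · obtain ⟨u, hu⟩ := hv
        have hqv : vertexHom ι S q v = v := by
          refine vertexHom_eq_self_of_head hq fun y hy r hr => ?_
          rw [hu, List.cons.injEq] at hr
          exact hx (hr.1 ▸ hy)
        have := congrArg (fun f => f v) h1
        simpa only [map_mul, Equiv.Perm.mul_apply, hqv] using this
      · refine vertexHom_eq_self_of_head hp ?_
        rintro _ rfl u hu
        exact hv ⟨u, hu⟩
    have hp' : p = 1 := by
      obtain ⟨σ, hσ, hσx⟩ := exists_perm_base (ι := ι) hS x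
      have hm := conj_mem_headGroup (a := rootGen σ hσ) rfl hp
      have hb : (rootGen (ι := ι) σ hσ).perm⁻¹ x = base ι x.1 := by
        rw [Equiv.Perm.inv_eq_iff_eq]
        exact hσx.symm
      rw [hb] at hm
      have := eq_one_of_mem_headGroup_base ih hm (by simp [hp1])
      rwa [mul_assoc, inv_mul_eq_one, eq_comm, mul_eq_right] at this
    subst hp'
    rw [one_mul] at h1 hg ⊢
    exact ihF hq h1

/-- On sequences of one letter only the factor `h(σ)` of `exists_eq_gen_mul` acts, so it is trivial;
the other factor falls to the induction on the depth. -/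
theorem eq_one_of_mem_depthGroup (hS : ∀ ε, ∀ i j : I ε, ∃ σ ∈ S ε, σ i = j) (n : ℕ) :
    ∀ g ∈ depthGroup ι S n, vertexHom ι S g = 1 → g = 1 := by
  have key : ∀ (n : ℕ) (g : VertexGroup ι S), g ∈ depthGroup ι S n → vertexHom ι S g = 1 →
      ∃ F : Set (Letter I), F.Finite ∧ g ∈ headGroup ι S n F := by
    intro n g hg h
    obtain ⟨a, ha, F, hF, k, hk, rfl⟩ := exists_eq_gen_mul hg
    have hp : a.perm = 1 := by
      ext1 x
      have h2 := congrArg (fun f => f (single x)) h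
      simp only [map_mul, Equiv.Perm.mul_apply, vertexHom_single hk,
        vertexHom_rootGen_single ha] at h2
      exact single_injective h2
    rw [gen_eq_one hp, one_mul]
    exact ⟨F, hF, hk⟩
  induction n with
  | zero =>
    intro g hg h
    obtain ⟨F, -, hk⟩ := key 0 g hg h
    induction hk using wordGroup_induction with
    | one => rfl
    | mul a g ha =>
      obtain ⟨hl, x, -, v, hv⟩ := ha
      simp [hv] at hl
  | succ n ih =>
    intro g hg h
    obtain ⟨F, hF, hk⟩ := key (n + 1) g hg h
    exact eq_one_of_mem_headGroup hS ih hF hk h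

/-- The action of `G` on the vertices is faithful. -/
theorem vertexHom_injective (hS : ∀ ε, ∀ i j : I ε, ∃ σ ∈ S ε, σ i = j) :
    Function.Injective (vertexHom ι S) := by
  rw [injective_iff_map_eq_one]
  intro g h
  obtain ⟨n, hn⟩ := exists_mem_depthGroup g
  exact eq_one_of_mem_depthGroup hS n g hn h

end Faithful

/-! ### The tree: stabilizer of the root, faithfulness for `Λ`, signs of edges, transitivity -/

section Tree

variable {I : ℤˣ → Type u} {ι : ∀ ε, I ε} {S : ∀ ε, Subgroup (Equiv.Perm (I ε))}

theorem permAt_append_singleton {σ : Equiv.Perm (Letter I)} (hσ : ∀ x, (σ x).1 = x.1)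
    (w v : List (Letter I)) (x : Letter I) :
    ∃ y : Letter I, y.1 = x.1 ∧ permAt σ w (v ++ [x]) = permAt σ w v ++ [y] := by
  induction w generalizing v with
  | nil =>
    rcases v with _ | ⟨z, v⟩
    · exact ⟨σ x, hσ x, by simp [permAt_nil_left, mapHead]⟩
    · exact ⟨x, rfl, by simp [permAt_nil_left, mapHead]⟩
  | cons z w ih =>
    rcases v with _ | ⟨z', v⟩
    · refine ⟨x, rfl, ?_⟩
      rw [permAt_nil_right, List.nil_append]
      by_cases h : z = x
      · rw [h, permAt_cons_self, permAt_nil_right]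
      · exact permAt_cons_of_ne _ h _ _
    · by_cases h : z = z'
      · subst h
        obtain ⟨y, hy, h⟩ := ih v
        exact ⟨y, hy, by rw [List.cons_append, permAt_cons_self, permAt_cons_self, h,
          List.cons_append]⟩
      · exact ⟨x, rfl, by rw [List.cons_append, permAt_cons_of_ne _ h, permAt_cons_of_ne _ h,
          List.cons_append]⟩

/-- Only at the vertex `w` is the next letter altered: beyond `w` the altered letter already belongs
to `v`. This is the source of finiteness in `finite_singular`. -/
theorem permAt_append_singleton_of_ne (σ : Equiv.Perm (Letter I)) {w v : List (Letter I)}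
    (hv : v ≠ w) (x : Letter I) : permAt σ w (v ++ [x]) = permAt σ w v ++ [x] := by
  by_cases h : w <+: v
  · obtain ⟨v, rfl⟩ := h
    rcases v with _ | ⟨z, v⟩
    · simp at hv
    · rw [List.append_assoc, permAt_append, permAt_append]
      simp [mapHead]
  · rw [permAt_of_not_prefix _ h]
    by_cases h' : w <+: v ++ [x]
    · obtain h' | h' := List.prefix_concat_iff.1 h'
      · rw [← h']
        simpa [mapHead] using permAt_append σ w []
      · exact absurd h' h
    · exact permAt_of_not_prefix _ h'

theorem length_permAt (σ : Equiv.Perm (Letter I)) (w v : List (Letter I)) :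
    (permAt σ w v).length = v.length := by
  by_cases h : w <+: v
  · obtain ⟨v, rfl⟩ := h
    rw [permAt_append]
    cases v <;> simp [mapHead]
  · rw [permAt_of_not_prefix _ h]

theorem length_vertexHom (g : VertexGroup ι S) (v : Vertex ι) :
    (vertexHom ι S g v).1.length = v.1.length := by
  induction mem_wordGroup_true g using wordGroup_induction with
  | one => simp
  | mul a g _ _ ih => rw [map_mul, Equiv.Perm.mul_apply, coe_vertexHom_gen, length_permAt, ih]

theorem vertexHom_root (g : VertexGroup ι S) : vertexHom ι S g root = root :=
  Subtype.ext (List.length_eq_zero_iff.1 (length_vertexHom g root))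

theorem vertexHom_append (g : VertexGroup ι S) {v w : Vertex ι} {x : Letter I}
    (h : w.1 = v.1 ++ [x]) :
    ∃ y : Letter I, y.1 = x.1 ∧ (vertexHom ι S g w).1 = (vertexHom ι S g v).1 ++ [y] := by
  induction mem_wordGroup_true g using wordGroup_induction with
  | one => exact ⟨x, rfl, by simpa using h⟩
  | mul a g _ _ ih =>
    obtain ⟨y, hy, h⟩ := ih
    obtain ⟨z, hz, h'⟩ := permAt_append_singleton (prodGroup_fst a.mem) a.word
      (vertexHom ι S g v).1 y
    refine ⟨z, hz.trans hy, ?_⟩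
    rw [map_mul, Equiv.Perm.mul_apply, Equiv.Perm.mul_apply, coe_vertexHom_gen,
      coe_vertexHom_gen, h, h']

theorem vertexHom_cons (g : VertexGroup ι S) {v : Vertex ι} {x : Letter I} {r : List (Letter I)}
    (h : v.1 = x :: r) :
    ∃ z : Letter I, z.1 = x.1 ∧ vertexHom ι S g (single x) = single z ∧
      ∃ r', (vertexHom ι S g v).1 = z :: r' := by
  induction mem_wordGroup_true g using wordGroup_induction with
  | one => exact ⟨x, rfl, by simp, r, by simpa using h⟩
  | mul a g _ _ ih =>
    obtain ⟨z, hz, h1, r', h2⟩ := ih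
    rw [map_mul, Equiv.Perm.mul_apply, Equiv.Perm.mul_apply, h1]
    rcases hw : a.word with _ | ⟨y, w⟩
    · refine ⟨a.perm z, (prodGroup_fst a.mem z).trans hz, vertexHom_rootGen_single hw z, r', ?_⟩
      rw [coe_vertexHom_gen, h2, hw, permAt_nil_left, mapHead]
    · refine ⟨z, hz, Subtype.ext ?_, ?_⟩
      · rw [coe_vertexHom_gen, single, hw]
        by_cases hy : y = z
        · rw [hy, permAt_cons_self, permAt_nil_right]
        · exact permAt_cons_of_ne _ hy _ _
      · rw [coe_vertexHom_gen, h2, hw]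
        by_cases hy : y = z
        · rw [hy, permAt_cons_self]
          exact ⟨_, rfl⟩
        · rw [permAt_cons_of_ne _ hy]
          exact ⟨_, rfl⟩

theorem toSubgroup_eq (u : ℤˣ) :
    HNNExtension.toSubgroup (edgeGroup ι S (-1)) (edgeGroup ι S 1) u = edgeGroup ι S (-u) := by
  rcases Int.units_eq_one_or u with rfl | rfl
  · rfl
  · simp

/-- Britton's lemma read off from the tree: in a product without pinches each stable letter puts one
more letter in front. The second clause carries the induction, as it shows where a cancellation
would have to occur. -/
theorem length_prod_smul_root (L : List (ℤˣ × VertexGroup ι S))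
    (hL : L.IsChain fun a b => a.2 ∈ edgeGroup ι S (-a.1) → a.1 = b.1) :
    (((L.map fun x => (HNNExtension.t : HNNGroup ι S) ^ (x.1 : ℤ) * HNNExtension.of x.2).prod •
      root : Vertex ι) : List (Letter I)).length = L.length ∧
    ∀ a ∈ L.head?, ∃ r,
      (((L.map fun x => (HNNExtension.t : HNNGroup ι S) ^ (x.1 : ℤ) * HNNExtension.of x.2).prod •
      root : Vertex ι) : List (Letter I)) = base ι a.1 :: r := by
  induction L with
  | nil => simp [root]
  | cons a L ih =>
    rw [List.isChain_cons] at hL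
    obtain ⟨h1, h2⟩ := ih hL.2
    rw [List.map_cons, List.prod_cons, mul_smul, mul_smul, coe_t_zpow_smul, of_smul]
    set v : Vertex ι := (L.map fun x =>
      (HNNExtension.t : HNNGroup ι S) ^ (x.1 : ℤ) * HNNExtension.of x.2).prod • root with hv
    suffices h : shiftWord ι (-a.1) (vertexHom ι S a.2 v).1 =
        base ι a.1 :: (vertexHom ι S a.2 v).1 by
      rw [h]
      simp [length_vertexHom, h1]
    rcases L with _ | ⟨b, L⟩
    · have hv' : v = root := by simp [hv]
      rw [hv', vertexHom_root]
      simp [root, shiftWord]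
    · obtain ⟨r, hr⟩ := h2 b (by simp)
      obtain ⟨z, hz, h3, r', h4⟩ := vertexHom_cons a.2 hr
      rw [h4, shiftWord_cons, neg_neg]
      -- A removed first letter would mean that `a.2` fixes `(ι_{-a.1}, a.1)` and that the signs
      -- `a.1`, `b.1` are opposite, which is a pinch.
      rintro rfl
      have hb : -a.1 = b.1 := hz
      rw [← hb] at h3
      have := hL.1 b (by simp) (mem_edgeGroup_of_fix h3)
      rw [← this] at hb
      simp at hb

/-- The stabilizer of the root in `Λ` is `G`. -/
theorem exists_of_eq_of_smul_root {g : HNNGroup ι S} (h : g • (root : Vertex ι) = root) :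
    ∃ k : VertexGroup ι S, HNNExtension.of k = g := by
  obtain ⟨d⟩ := HNNExtension.NormalWord.TransversalPair.nonempty (VertexGroup ι S)
    (edgeGroup ι S (-1)) (edgeGroup ι S 1)
  obtain ⟨w, rfl⟩ := (HNNExtension.NormalWord.equiv (theta ι S) d).symm.surjective g
  have hw : (HNNExtension.NormalWord.equiv (theta ι S) d).symm w = HNNExtension.of w.head *
    (w.toList.map fun x => (HNNExtension.t : HNNGroup ι S) ^ (x.1 : ℤ) *
      HNNExtension.of x.2).prod := rfl
  rw [hw] at h ⊢
  have hc := w.chain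
  simp only [toSubgroup_eq] at hc
  have hl := (length_prod_smul_root w.toList hc).1
  rw [mul_smul, of_smul] at h
  rw [← length_vertexHom w.head, h] at hl
  have hnil := List.length_eq_zero_iff.1 (hl.symm.trans rfl)
  exact ⟨w.head, by simp [hnil]⟩

/-- The action of `Λ` on the vertices is faithful. -/
theorem eq_one_of_forall_smul (hS : ∀ ε, ∀ i j : I ε, ∃ σ ∈ S ε, σ i = j) {g : HNNGroup ι S}
    (h : ∀ v : Vertex ι, g • v = v) : g = 1 := by
  obtain ⟨k, rfl⟩ := exists_of_eq_of_smul_root (h root)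
  have : vertexHom ι S k = 1 := Equiv.ext fun v => by rw [← of_smul, h v]; rfl
  rw [(vertexHom_injective hS) (this.trans (map_one _).symm), map_one]

/-- `w` is a neighbour of `v`, and `ε` is the sign of the edge from `v` to `w`. -/
def SignedAdj (ε : ℤˣ) (v w : Vertex ι) : Prop :=
  (∃ x : Letter I, x.1 = ε ∧ w.1 = v.1 ++ [x]) ∨ ∃ x : Letter I, x.1 = -ε ∧ v.1 = w.1 ++ [x]

theorem SignedAdj.symm {ε : ℤˣ} {v w : Vertex ι} (h : SignedAdj ε v w) : SignedAdj (-ε) w v := by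
  rcases h with h | h
  · exact Or.inr (by rwa [neg_neg])
  · exact Or.inl h

theorem signedAdj_of_append {v w : Vertex ι} {x : Letter I} (h : w.1 = v.1 ++ [x]) :
    SignedAdj x.1 v w := Or.inl ⟨x, rfl, h⟩

/-- The shift reverses the direction away from the root only on the edge from the root to `(ι_δ,
-δ)`, and there the new letter has the opposite sign, which compensates. -/
theorem signedAdj_shiftPerm (δ : ℤˣ) {ε : ℤˣ} {v w : Vertex ι} (h : SignedAdj ε v w) :
    SignedAdj ε (shiftPerm ι δ v) (shiftPerm ι δ w) := by
  have key : ∀ {v w : Vertex ι} {x : Letter I}, w.1 = v.1 ++ [x] →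
      SignedAdj x.1 (shiftPerm ι δ v) (shiftPerm ι δ w) := by
    intro v w x h
    by_cases hv : v.1 = []
    · by_cases hx : x = base ι δ
      · refine Or.inr ⟨base ι (-δ), by rw [hx]; rfl, ?_⟩
        rw [coe_shiftPerm, coe_shiftPerm, h, hv, hx, List.nil_append, shiftWord_base]
        rfl
      · refine Or.inl ⟨x, rfl, ?_⟩
        rw [coe_shiftPerm, coe_shiftPerm, h, hv, List.nil_append, shiftWord_cons hx]
        rfl
    · exact Or.inl ⟨x, rfl, by rw [coe_shiftPerm, coe_shiftPerm, h, shiftWord_append _ hv]⟩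
  rcases h with ⟨x, rfl, h⟩ | ⟨x, hx, h⟩
  · exact key h
  · have := (key h).symm
    rwa [hx, neg_neg] at this

theorem signedAdj_vertexHom (g : VertexGroup ι S) {ε : ℤˣ} {v w : Vertex ι}
    (h : SignedAdj ε v w) : SignedAdj ε (vertexHom ι S g v) (vertexHom ι S g w) := by
  rcases h with ⟨x, hx, h⟩ | ⟨x, hx, h⟩
  · obtain ⟨y, hy, h⟩ := vertexHom_append g h
    exact Or.inl ⟨y, hy.trans hx, h⟩
  · obtain ⟨y, hy, h⟩ := vertexHom_append g h
    exact Or.inr ⟨y, hy.trans hx, h⟩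

theorem t_zpow_smul (u : ℤˣ) (v : Vertex ι) :
    (HNNExtension.t : HNNGroup ι S) ^ (u : ℤ) • v = shiftPerm ι (-u) v :=
  Subtype.ext (coe_t_zpow_smul u v)

theorem t_smul (v : Vertex ι) : (HNNExtension.t : HNNGroup ι S) • v = shiftPerm ι (-1) v := by
  simpa using t_zpow_smul (S := S) 1 v

theorem t_inv_smul (v : Vertex ι) : (HNNExtension.t : HNNGroup ι S)⁻¹ • v = shiftPerm ι 1 v := by
  simpa using t_zpow_smul (S := S) (-1) v

/-- The inverse is included so that the case of an inverse in the induction is a mere exchange. -/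
theorem SignedAdj.smul_and_inv_smul (g : HNNGroup ι S) :
    ∀ (ε : ℤˣ) (v w : Vertex ι), SignedAdj ε v w →
      SignedAdj ε (g • v) (g • w) ∧ SignedAdj ε (g⁻¹ • v) (g⁻¹ • w) := by
  induction g using HNNExtension.induction_on with
  | of g =>
    intro ε v w h
    rw [← map_inv]
    simp only [of_smul]
    exact ⟨signedAdj_vertexHom g h, signedAdj_vertexHom g⁻¹ h⟩
  | t =>
    intro ε v w h
    simp only [t_smul, t_inv_smul]
    exact ⟨signedAdj_shiftPerm _ h, signedAdj_shiftPerm _ h⟩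
  | mul x y hx hy =>
    intro ε v w h
    simp only [mul_inv_rev, mul_smul]
    exact ⟨(hx _ _ _ (hy _ _ _ h).1).1, (hy _ _ _ (hx _ _ _ h).2).2⟩
  | inv x hx =>
    intro ε v w h
    rw [inv_inv]
    exact (hx ε v w h).symm

theorem SignedAdj.smul (g : HNNGroup ι S) {ε : ℤˣ} {v w : Vertex ι} (h : SignedAdj ε v w) :
    SignedAdj ε (g • v) (g • w) := (SignedAdj.smul_and_inv_smul g ε v w h).1

/-- Only the stable letter changes the distance to the root, by one each time. The bound is used in
`pow_smul_ne` to compare orbits of conjugate elements. -/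
theorem exists_length_le (g : HNNGroup ι S) : ∃ C, ∀ v : Vertex ι,
    (g • v).1.length ≤ v.1.length + C ∧ v.1.length ≤ (g • v).1.length + C := by
  induction g using HNNExtension.induction_on with
  | of g => exact ⟨0, fun v => by simp [of_smul, length_vertexHom]⟩
  | t =>
    refine ⟨1, fun v => ?_⟩
    rw [t_smul, coe_shiftPerm]
    rcases v with ⟨_ | ⟨x, v⟩, _⟩
    · simp [shiftWord]
    · rw [shiftWord]
      split_ifs
      · simp only [List.length_cons]
        omega
      · simp only [List.length_cons]
        omega
  | mul x y hx hy =>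
    obtain ⟨C, hC⟩ := hx
    obtain ⟨D, hD⟩ := hy
    refine ⟨C + D, fun v => ?_⟩
    have h1 := hC (y • v)
    have h2 := hD v
    rw [mul_smul]
    omega
  | inv x hx =>
    obtain ⟨C, hC⟩ := hx
    refine ⟨C, fun v => ?_⟩
    have := hC (x⁻¹ • v)
    rw [smul_inv_smul] at this
    exact this.symm

/-- A power of the stable letter puts the base point of the right sign in front, and some `h(σ)`
turns it into `z`. Admissibility of `v` excludes that the stable letter cancels. -/
theorem exists_smul_eq_cons (hS : ∀ ε, ∀ i j : I ε, ∃ σ ∈ S ε, σ i = j) (z : Letter I) :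
    ∃ p : HNNGroup ι S, ∀ u v : Vertex ι, v.1 = z :: u.1 → p • u = v := by
  obtain ⟨σ, hσ, hz⟩ := exists_perm_base (ι := ι) hS z
  refine ⟨HNNExtension.of (gen (rootGen σ hσ)) * HNNExtension.t ^ (z.1 : ℤ), fun u v h => ?_⟩
  have hu : ∀ r, u.1 ≠ base ι (-z.1) :: r := by
    intro r hr
    have := v.2
    rw [h, hr] at this
    exact (isReduced_cons_cons.1 this).1 rfl
  have h1 : shiftWord ι (-z.1) u.1 = base ι z.1 :: u.1 := by
    rcases hw : u.1 with _ | ⟨x, r⟩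
    · simp [shiftWord]
    · rw [shiftWord_cons, neg_neg]
      rintro rfl
      exact hu r hw
  refine Subtype.ext ?_
  rw [mul_smul, of_smul, coe_vertexHom_gen, coe_t_zpow_smul, h1, h]
  simp only [rootGen, permAt_nil_left, mapHead, hz]

theorem exists_smul_root_eq (hS : ∀ ε, ∀ i j : I ε, ∃ σ ∈ S ε, σ i = j) (v : Vertex ι) :
    ∃ p : HNNGroup ι S, p • root = v := by
  obtain ⟨v, hv⟩ := v
  induction v with
  | nil => exact ⟨1, one_smul _ _⟩
  | cons z v ih =>
    obtain ⟨p, hp⟩ := ih (isReduced_tail hv)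
    obtain ⟨q, hq⟩ := exists_smul_eq_cons hS z
    exact ⟨q * p, by rw [mul_smul, hp, hq _ ⟨z :: v, hv⟩ rfl]⟩

theorem isReduced_of_append {v w : List (Letter I)} (h : IsReduced ι (v ++ w)) :
    IsReduced ι v := by
  rw [isReduced_iff] at *
  exact h.left_of_append

/-- Induction on the vertices along the edges that lead away from the root. -/
@[elab_as_elim]
theorem vertex_induction {motive : Vertex ι → Prop} (root : motive root)
    (append : ∀ (v w : Vertex ι) (x : Letter I), w.1 = v.1 ++ [x] → motive v → motive w)
    (v : Vertex ι) : motive v := by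
  obtain ⟨v, hv⟩ := v
  induction v using List.reverseRecOn with
  | nil => exact root
  | append_singleton v x ih =>
    exact append ⟨v, isReduced_of_append hv⟩ _ x rfl (ih _)

end Tree

/-! ### Elements with a fixed vertex -/

section Dynamics

variable {I : ℤˣ → Type u} {ι : ∀ ε, I ε} {S : ∀ ε, Subgroup (Equiv.Perm (I ε))}

/-- The vertices that are fixed by `g` and have a neighbour that is moved by `g`. -/
def fixBoundary (g : HNNGroup ι S) : Set (Vertex ι) :=
  {v | g • v = v ∧ ∃ ε u, SignedAdj ε v u ∧ g • u ≠ u}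

theorem smul_fixBoundary (p g : HNNGroup ι S) :
    fixBoundary (p * g * p⁻¹) = p • fixBoundary g := by
  have key : ∀ (p g : HNNGroup ι S) (v : Vertex ι), v ∈ fixBoundary g →
      p • v ∈ fixBoundary (p * g * p⁻¹) := by
    rintro p g v ⟨h1, ε, u, h2, h3⟩
    refine ⟨by simp [mul_smul, h1], ε, p • u, h2.smul p, fun h => h3 ?_⟩
    simpa [mul_smul] using h
  ext v
  rw [Set.mem_smul_set_iff_inv_smul_mem]
  constructor
  · intro h
    simpa [mul_assoc] using key p⁻¹ _ v h
  · intro h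
    simpa using key p g _ h

/-- A further factor `a` adds at most one vertex, the one that is mapped to `a.word`. -/
theorem finite_singular (k : VertexGroup ι S) :
    {v : Vertex ι | ∃ (u : Vertex ι) (x : Letter I), u.1 = v.1 ++ [x] ∧
      (vertexHom ι S k u).1 ≠ (vertexHom ι S k v).1 ++ [x]}.Finite := by
  induction mem_wordGroup_true k using wordGroup_induction with
  | one =>
    convert! Set.finite_empty
    ext v
    simp
  | mul a g _ _ ih =>
    refine (ih.union ((Set.finite_singleton a.word).preimage (f := fun v : Vertex ι =>
      (vertexHom ι S g v).1) (Subtype.val_injective.comp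
        (vertexHom ι S g).injective).injOn)).subset ?_
    rintro v ⟨u, x, h1, h2⟩
    by_contra hv
    rw [Set.mem_union, not_or] at hv
    obtain ⟨h3, h4⟩ := hv
    apply h2
    have h5 : (vertexHom ι S g u).1 = (vertexHom ι S g v).1 ++ [x] := by
      by_contra h6
      exact h3 ⟨u, x, h1, h6⟩
    rw [map_mul, Equiv.Perm.mul_apply, Equiv.Perm.mul_apply, coe_vertexHom_gen,
      coe_vertexHom_gen, h5]
    exact permAt_append_singleton_of_ne _ h4 x

/-- An element of `G` that fixes a vertex fixes its predecessor, so the moved neighbour is an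
extension by a letter that gets altered. -/
theorem finite_fixBoundary_of (k : VertexGroup ι S) :
    (fixBoundary (HNNExtension.of k : HNNGroup ι S)).Finite := by
  refine (finite_singular k).subset ?_
  rintro v ⟨h1, ε, u, h2, h3⟩
  rw [of_smul] at h1 h3
  rcases h2 with ⟨x, -, h⟩ | ⟨x, -, h⟩
  · refine ⟨u, x, h, fun h' => h3 (Subtype.ext ?_)⟩
    rw [h', h1, h]
  · obtain ⟨y, -, h'⟩ := vertexHom_append k h
    rw [h1, h] at h'
    exact absurd (Subtype.ext (List.append_inj_left' h' rfl).symm) h3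

/-- Otherwise being fixed spreads from the root to all vertices, against faithfulness. -/
theorem nonempty_fixBoundary_of (hS : ∀ ε, ∀ i j : I ε, ∃ σ ∈ S ε, σ i = j)
    {g : HNNGroup ι S} (hg : g ≠ 1) (h : g • (root : Vertex ι) = root) :
    (fixBoundary g).Nonempty := by
  by_contra h0
  rw [Set.not_nonempty_iff_eq_empty] at h0
  refine hg (eq_one_of_forall_smul hS fun v => ?_)
  induction v using vertex_induction with
  | root => exact h
  | append v w x hw ih =>
    by_contra hne
    have : v ∈ fixBoundary g := ⟨ih, _, w, signedAdj_of_append hw, hne⟩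
    rw [h0] at this
    exact this

theorem fixBoundary_finite_nonempty (hS : ∀ ε, ∀ i j : I ε, ∃ σ ∈ S ε, σ i = j)
    {g : HNNGroup ι S} (hg : g ≠ 1) {v : Vertex ι} (hv : g • v = v) :
    (fixBoundary g).Finite ∧ (fixBoundary g).Nonempty := by
  obtain ⟨p, rfl⟩ := exists_smul_root_eq hS v
  have h1 : (p⁻¹ * g * p) • (root : Vertex ι) = root := by
    rw [mul_smul, mul_smul, hv, inv_smul_smul]
  have h2 : p⁻¹ * g * p ≠ 1 := fun h => hg (by
    rw [mul_assoc, inv_mul_eq_one, eq_comm, mul_eq_right] at h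
    exact h)
  have h3 : g = p * (p⁻¹ * g * p) * p⁻¹ := by group
  have hne := nonempty_fixBoundary_of hS h2 h1
  obtain ⟨k, hk⟩ := exists_of_eq_of_smul_root h1
  rw [h3, smul_fixBoundary]
  rw [← hk] at hne ⊢
  exact ⟨(finite_fixBoundary_of k).smul_set, hne.smul_set⟩

/-! ### Elements without a fixed vertex -/

/-- If `(y)` is mapped to the predecessor of the image of the root, then the sequences that do not
begin with `y` are mapped to extensions of the image of the root. -/
theorem smul_eq_append {g : HNNGroup ι S} {w' : Vertex ι} {y : Letter I}
    (hy : g • single y = w') {x : Letter I}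
    (hw : (g • (root : Vertex ι)).1 = w'.1 ++ [x]) (v : Vertex ι)
    (hv : ∀ r, v.1 ≠ y :: r) :
    ∃ s, (g • v).1 = (g • (root : Vertex ι)).1 ++ s ∧ s.length = v.1.length := by
  obtain ⟨n, hn⟩ : ∃ n, v.1.length = n := ⟨_, rfl⟩
  induction n using Nat.strong_induction_on generalizing v with
  | _ n ih =>
  induction v using vertex_induction with
  | root => exact ⟨[], by simp, rfl⟩
  | append v₁ v a ha _ =>
    have hl : v.1.length = v₁.1.length + 1 := by simp [ha]
    have hv₁ : ∀ r, v₁.1 ≠ y :: r := fun r hr => hv (r ++ [a]) (by simp [ha, hr])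
    obtain ⟨s, hs, hsl⟩ := ih v₁.1.length (by omega) v₁ hv₁ rfl
    rcases (signedAdj_of_append ha).smul g with ⟨c, -, hc⟩ | ⟨c, -, hc⟩
    · exact ⟨s ++ [c], by rw [hc, hs, List.append_assoc], by simp [hsl, hl]⟩
    -- Here the image path would turn back at `g • v₁`, so `v` would have the same image as `(y)` or
    -- as the predecessor of `v₁`.
    · exfalso
      induction v₁ using vertex_induction with
      | root =>
        rw [hw] at hc
        have h1 : w' = g • v := Subtype.ext (List.append_inj_left' hc rfl)
        rw [← hy] at h1
        exact hv [] (by rw [← smul_left_cancel g h1]; rfl)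
      | append v₂ v₁ b hb _ =>
        have hl' : v₁.1.length = v₂.1.length + 1 := by simp [hb]
        have hv₂ : ∀ r, v₂.1 ≠ y :: r := fun r hr => hv₁ (r ++ [b]) (by simp [hb, hr])
        obtain ⟨s', hs', hsl'⟩ := ih v₂.1.length (by omega) v₂ hv₂ rfl
        have hlen := congrArg List.length hs
        have hlen' := congrArg List.length hs'
        rcases (signedAdj_of_append hb).smul g with ⟨d, -, hd⟩ | ⟨d, -, hd⟩
        · rw [hd] at hc
          have h1 : g • v₂ = g • v := Subtype.ext (List.append_inj_left' hc rfl)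
          rw [smul_left_cancel g h1] at hl'
          omega
        · have := congrArg List.length hd
          simp only [List.length_append, List.length_singleton] at this hlen hlen'
          omega

/-- When the path from the root to its image does not start with `y`, the successive images of this
path concatenate without backtracking. -/
theorem le_length_pow_smul {g : HNNGroup ι S} {w' : Vertex ι} {y : Letter I}
    (hy : g • single y = w') {x : Letter I}
    (hw : (g • (root : Vertex ι)).1 = w'.1 ++ [x])
    (hne : ∀ r, (g • (root : Vertex ι)).1 ≠ y :: r) (j : ℕ) :
    j ≤ (g ^ j • (root : Vertex ι)).1.length ∧ ∀ r, (g ^ j • (root : Vertex ι)).1 ≠ y :: r := by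
  induction j with
  | zero => simp [root]
  | succ j ih =>
    obtain ⟨s, hs, hl⟩ := smul_eq_append hy hw _ ih.2
    rw [pow_succ', mul_smul, hs]
    rw [hw] at hne ⊢
    refine ⟨by simp [hl]; omega, fun r hr => ?_⟩
    rcases h : w'.1 ++ [x] with _ | ⟨z, q⟩
    · simp at h
    · rw [h, List.cons_append, List.cons.injEq] at hr
      exact hne q (by rw [h, hr.1])

/-- Induction on the distance from the root to its image. If the path between them starts with the
edge that `g` maps to its last edge, conjugation moves the root along that edge and shortens the
distance by two; otherwise `le_length_pow_smul` applies. -/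
theorem fix_or_unbounded (hS : ∀ ε, ∀ i j : I ε, ∃ σ ∈ S ε, σ i = j) (g : HNNGroup ι S) :
    (∃ v : Vertex ι, g • v = v) ∨
      ∃ p : HNNGroup ι S, ∀ j : ℕ, j ≤ ((p⁻¹ * g * p) ^ j • (root : Vertex ι)).1.length := by
  obtain ⟨n, hn⟩ : ∃ n, (g • (root : Vertex ι)).1.length = n := ⟨_, rfl⟩
  induction n using Nat.strong_induction_on generalizing g with
  | _ n ih =>
  by_cases h0 : g • (root : Vertex ι) = root
  · exact Or.inl ⟨root, h0⟩
  obtain ⟨w', x, hw⟩ : ∃ (w' : Vertex ι) (x : Letter I),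
      (g • (root : Vertex ι)).1 = w'.1 ++ [x] := by
    generalize g • (root : Vertex ι) = w at h0
    induction w using vertex_induction with
    | root => exact absurd rfl h0
    | append w' w x hx _ => exact ⟨w', x, hx⟩
  obtain ⟨y, hy⟩ : ∃ y, g • single y = w' := by
    have h1 := (signedAdj_of_append hw).symm.smul g⁻¹
    rw [inv_smul_smul] at h1
    rcases h1 with ⟨y, -, h1⟩ | ⟨y, -, h1⟩
    · refine ⟨y, ?_⟩
      rw [← eq_inv_smul_iff]
      exact Subtype.ext h1.symm
    · simp [root] at h1
  by_cases hne : ∀ r, (g • (root : Vertex ι)).1 ≠ y :: r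
  · exact Or.inr ⟨1, fun j => by simpa using (le_length_pow_smul hy hw hne j).1⟩
  push Not at hne
  obtain ⟨r, hr⟩ := hne
  obtain ⟨p, hp⟩ := exists_smul_eq_cons (S := S) hS y
  have hp0 : p • (root : Vertex ι) = single y := hp _ _ rfl
  rcases hw' : w'.1 with _ | ⟨z, q⟩
  -- Here `g` would exchange the root and `(y)`; this inversion is excluded by the sign of the edge.
  · exfalso
    have hwr : w' = root := Subtype.ext hw'
    have h1 : g • (root : Vertex ι) = single y := by
      refine Subtype.ext ?_
      rw [hw, hw'] at hr
      rw [hw, hw', hr]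
      simp only [List.nil_append, List.cons.injEq] at hr
      rw [← hr.2]
      rfl
    have h2 := (signedAdj_of_append (v := root) (w := single y) (x := y) rfl).smul g
    rw [hy, h1, hwr] at h2
    rcases h2 with ⟨c, -, hc⟩ | ⟨c, hc1, hc⟩
    · simp [root] at hc
    · have : c = y := by simpa [single, root] using hc.symm
      rw [this] at hc1
      exact units_ne_neg_self _ hc1
  · have hz : z = y := by
      rw [hw, hw', List.cons_append, List.cons.injEq] at hr
      exact hr.1
    subst hz
    have hred : IsReduced ι q := by
      have := w'.2
      rw [hw'] at this
      exact isReduced_tail this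
    have h1 : (p⁻¹ * g * p) • (root : Vertex ι) = ⟨q, hred⟩ := by
      rw [mul_smul, mul_smul, hp0, hy, inv_smul_eq_iff]
      exact (hp ⟨q, hred⟩ w' hw').symm
    have hlen : (g • (root : Vertex ι)).1.length = q.length + 2 := by simp [hw, hw']
    rcases ih q.length (by omega) (p⁻¹ * g * p) (by rw [h1]) with ⟨v, hv⟩ | ⟨p', hp'⟩
    · refine Or.inl ⟨p • v, ?_⟩
      rwa [mul_smul, mul_smul, inv_smul_eq_iff] at hv
    · refine Or.inr ⟨p * p', fun j => ?_⟩
      have : (p * p')⁻¹ * g * (p * p') = p'⁻¹ * (p⁻¹ * g * p) * p' := by group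
      rw [this]
      exact hp' j

/-- If an element of `Λ` fixes no vertex, then neither do its non-trivial powers. -/
theorem pow_smul_ne (hS : ∀ ε, ∀ i j : I ε, ∃ σ ∈ S ε, σ i = j) {g : HNNGroup ι S}
    (hg : ∀ v : Vertex ι, g • v ≠ v) {k : ℕ} (hk : 0 < k) (v : Vertex ι) : g ^ k • v ≠ v := by
  intro hv
  rcases fix_or_unbounded hS g with ⟨u, hu⟩ | ⟨p, hp⟩
  · exact hg u hu
  obtain ⟨q, hq⟩ := exists_smul_root_eq hS (p⁻¹ • v)
  set f := p⁻¹ * g * p with hf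
  have hfk : f ^ k = p⁻¹ * g ^ k * p := by
    have := conj_pow (i := k) (a := p⁻¹) (b := g)
    rwa [inv_inv] at this
  have h1 : (q⁻¹ * f ^ k * q) • (root : Vertex ι) = root := by
    rw [mul_smul, hq, hfk, mul_smul, mul_smul, mul_smul, smul_inv_smul, hv, inv_smul_eq_iff, hq]
  obtain ⟨h, hh⟩ := exists_of_eq_of_smul_root h1
  obtain ⟨C, hC⟩ := exists_length_le q
  have h2 : ∀ m : ℕ, f ^ (k * m) = q * HNNExtension.of (h ^ m) * q⁻¹ := by
    intro m
    rw [map_pow, hh]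
    have := conj_pow (i := m) (a := q) (b := q⁻¹ * f ^ k * q)
    rw [← this, pow_mul]
    congr 1
    group
  set l := (q⁻¹ • (root : Vertex ι)).1.length with hl
  -- The orbit of the root under powers of `f ^ k` stays within distance `l + C`, so this exponent
  -- exceeds what the linear growth allows.
  have h3 := hp (k * (l + C + 1))
  rw [h2, mul_smul, mul_smul, of_smul] at h3
  have h4 := (hC (vertexHom ι S (h ^ (l + C + 1)) (q⁻¹ • (root : Vertex ι)))).1
  rw [length_vertexHom, ← hl] at h4
  have h5 := Nat.le_mul_of_pos_left (l + C + 1) hk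
  omega

/-! ### Half-trees: eventual behaviour of powers, and disjoint translates -/

variable (ι) in
/-- The half-tree of all sequences that begin with `(ι_ε, -ε)`. -/
def halfTree (ε : ℤˣ) : Set (Vertex ι) := {v | ∃ r, v.1 = base ι ε :: r}

theorem eventually_ne_root (hS : ∀ ε, ∀ i j : I ε, ∃ σ ∈ S ε, σ i = j) {g : HNNGroup ι S}
    (hg : ∀ v : Vertex ι, g • v ≠ v) (v : Vertex ι) : ∀ᶠ n : ℕ in atTop, g ^ n • v ≠ root := by
  by_cases h : ∃ m : ℕ, g ^ m • v = root
  · obtain ⟨m, hm⟩ := h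
    filter_upwards [eventually_gt_atTop m] with n hn h
    refine pow_smul_ne hS hg (Nat.sub_pos_of_lt hn) (root : Vertex ι) ?_
    rw [← h]
    nth_rw 1 [h]
    rw [← hm, ← mul_smul, ← pow_add, Nat.sub_add_cancel hn.le]
  · push Not at h
    exact Eventually.of_forall h

theorem mem_halfTree_iff_of_append {δ : ℤˣ} {v w : Vertex ι} {x : Letter I}
    (h : w.1 = v.1 ++ [x]) (hv : v ≠ root) : w ∈ halfTree ι δ ↔ v ∈ halfTree ι δ := by
  rcases hv' : v.1 with _ | ⟨z, r⟩
  · exact absurd (Subtype.ext hv') hv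
  · simp [halfTree, h, hv']

theorem SignedAdj.mem_halfTree_iff {ε δ : ℤˣ} {v w : Vertex ι} (h : SignedAdj ε v w)
    (hv : v ≠ root) (hw : w ≠ root) : w ∈ halfTree ι δ ↔ v ∈ halfTree ι δ := by
  rcases h with ⟨x, -, h⟩ | ⟨x, -, h⟩
  · exact mem_halfTree_iff_of_append h hv
  · exact (mem_halfTree_iff_of_append h hw).symm

/-- The ends of a moved edge can be separated by the half-tree only when one of them is the root,
and an orbit meets the root at most once. Connectedness of the tree does the rest. -/
theorem eventually_mem_halfTree_iff (hS : ∀ ε, ∀ i j : I ε, ∃ σ ∈ S ε, σ i = j)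
    {g : HNNGroup ι S} (hg : ∀ v : Vertex ι, g • v ≠ v) (δ : ℤˣ) (v : Vertex ι) :
    ∀ᶠ n : ℕ in atTop, g ^ n • v ∈ halfTree ι δ ↔ g ^ n • root ∈ halfTree ι δ := by
  induction v using vertex_induction with
  | root => exact Eventually.of_forall fun _ => Iff.rfl
  | append v w x hw ih =>
    filter_upwards [ih, eventually_ne_root hS hg v, eventually_ne_root hS hg w] with n h1 h2 h3
    rw [← h1]
    exact ((signedAdj_of_append hw).smul (g ^ n)).mem_halfTree_iff h2 h3

/-- Comparing the orbits of the root and of `g • root`, which is the same orbit delayed by one step,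
shows that membership becomes constant. -/
theorem eventually_mem_halfTree (hS : ∀ ε, ∀ i j : I ε, ∃ σ ∈ S ε, σ i = j)
    {g : HNNGroup ι S} (hg : ∀ v : Vertex ι, g • v ≠ v) (δ : ℤˣ) :
    (∀ v : Vertex ι, ∀ᶠ n : ℕ in atTop, g ^ n • v ∈ halfTree ι δ) ∨
      ∀ v : Vertex ι, ∀ᶠ n : ℕ in atTop, g ^ n • v ∈ (halfTree ι δ)ᶜ := by
  obtain ⟨N, hN⟩ := eventually_atTop.1 (eventually_mem_halfTree_iff hS hg δ (g • root))
  have hc : ∀ n ≥ N, g ^ n • root ∈ halfTree ι δ ↔ g ^ N • root ∈ halfTree ι δ := by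
    intro n hn
    induction n, hn using Nat.le_induction with
    | base => rfl
    | succ n hn ih => rw [← ih, ← hN n hn, ← mul_smul, pow_succ]
  by_cases h : g ^ N • root ∈ halfTree ι δ
  · refine Or.inl fun v => ?_
    filter_upwards [eventually_mem_halfTree_iff hS hg δ v, eventually_ge_atTop N] with n h1 h2
    rwa [h1, hc n h2]
  · refine Or.inr fun v => ?_
    filter_upwards [eventually_mem_halfTree_iff hS hg δ v, eventually_ge_atTop N] with n h1 h2
    rwa [Set.mem_compl_iff, h1, hc n h2]

theorem exists_smul_halfTree (hS : ∀ ε, ∀ i j : I ε, ∃ σ ∈ S ε, σ i = j) (z : Letter I) :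
    ∃ p : HNNGroup ι S, ∀ v ∈ halfTree ι z.1, ∃ r, (p • v).1 = base ι z.1 :: z :: r := by
  obtain ⟨σ, hσ, hz⟩ := exists_perm_base (ι := ι) hS z
  refine ⟨HNNExtension.t ^ (z.1 : ℤ) * HNNExtension.of (gen (rootGen σ hσ)), ?_⟩
  rintro v ⟨r, hr⟩
  have hne : z ≠ base ι (-z.1) := fun h => units_ne_neg_self z.1 (congrArg Sigma.fst h)
  refine ⟨r, ?_⟩
  rw [mul_smul, coe_t_zpow_smul, of_smul, coe_vertexHom_gen, hr]
  simp only [rootGen, permAt_nil_left, mapHead, hz]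
  rw [shiftWord_cons hne, neg_neg]

/-- A ping-pong argument: `a` and `b` map the half-tree into itself, onto sequences with different
second letters. The translates by `a ^ n * b` are therefore disjoint; a second point of `I ε` is
needed for `b`. -/
theorem exists_disjoint_smul_halfTree (hI : ∀ ε, ∃ i : I ε, i ≠ ι ε)
    (hS : ∀ ε, ∀ i j : I ε, ∃ σ ∈ S ε, σ i = j) (ε : ℤˣ) :
    ∃ p : ℕ → HNNGroup ι S, ∀ m n, m < n →
      Disjoint (p m • halfTree ι ε) (p n • halfTree ι ε) := by
  obtain ⟨i, hi⟩ := hI ε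
  obtain ⟨a, ha⟩ := exists_smul_halfTree (ι := ι) hS (base ι ε)
  obtain ⟨b, hb⟩ := exists_smul_halfTree (ι := ι) hS ⟨ε, i⟩
  have hne : (⟨ε, i⟩ : Letter I) ≠ base ι ε := fun h => hi (by simpa [base] using h)
  have hpow : ∀ k : ℕ, ∀ v ∈ halfTree ι ε, a ^ k • v ∈ halfTree ι ε := by
    intro k v hv
    induction k with
    | zero => simpa using hv
    | succ k ih =>
      rw [pow_succ', mul_smul]
      obtain ⟨r, hr⟩ := ha _ ih
      exact ⟨_, hr⟩
  refine ⟨fun n => a ^ n * b, fun m n hmn => Set.disjoint_left.2 ?_⟩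
  rintro _ ⟨v, hv, rfl⟩ ⟨u, hu, h⟩
  obtain ⟨k, rfl⟩ := Nat.exists_eq_add_of_lt hmn
  simp only [add_assoc, pow_add, mul_assoc, mul_smul, smul_left_cancel_iff] at h
  rw [← mul_smul (a ^ k), pow_one, ← pow_succ, pow_succ', mul_smul] at h
  obtain ⟨r, hr⟩ := hb v hv
  obtain ⟨r', hr'⟩ := hb u hu
  obtain ⟨r'', hr''⟩ := ha _ (hpow k (b • u) ⟨_, hr'⟩)
  rw [h, hr] at hr''
  simp only [List.cons.injEq] at hr''
  exact hne hr''.2.1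

/-- A power of the stable letter maps the complement into the half-tree of the opposite sign. -/
theorem exists_disjoint_smul_compl_halfTree (hI : ∀ ε, ∃ i : I ε, i ≠ ι ε)
    (hS : ∀ ε, ∀ i j : I ε, ∃ σ ∈ S ε, σ i = j) (ε : ℤˣ) :
    ∃ p : ℕ → HNNGroup ι S, ∀ m n, m < n →
      Disjoint (p m • (halfTree ι ε)ᶜ) (p n • (halfTree ι ε)ᶜ) := by
  obtain ⟨p, hp⟩ := exists_disjoint_smul_halfTree hI hS (-ε)
  let s : HNNGroup ι S := HNNExtension.t ^ ((-ε : ℤˣ) : ℤ)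
  have hs : s • (halfTree ι ε)ᶜ ⊆ halfTree ι (-ε) := by
    rintro _ ⟨v, hv, rfl⟩
    have h1 : (s • v).1 = shiftWord ι ε v.1 := by
      rw [coe_t_zpow_smul, neg_neg]
    rcases hv' : v.1 with _ | ⟨x, r⟩
    · exact ⟨[], by rw [h1, hv']; rfl⟩
    · have hx : x ≠ base ι ε := by
        rintro rfl
        exact hv ⟨r, hv'⟩
      exact ⟨x :: r, by rw [h1, hv', shiftWord_cons hx]⟩
  refine ⟨fun n => p n * s, fun m n hmn => ?_⟩
  simp only [mul_smul]
  exact (hp m n hmn).mono (Set.smul_set_mono hs) (Set.smul_set_mono hs)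

end Dynamics

/-! ### Finitely additive means -/

section Mean

variable {Ω : Type*} {μ : Set Ω → ℝ}

theorem mean_empty (hadd : ∀ A B, Disjoint A B → μ (A ∪ B) = μ A + μ B) : μ ∅ = 0 := by
  simpa using hadd ∅ ∅ (Set.disjoint_empty ∅)

theorem mean_mono (h0 : ∀ A, 0 ≤ μ A) (hadd : ∀ A B, Disjoint A B → μ (A ∪ B) = μ A + μ B)
    {A B : Set Ω} (h : A ⊆ B) : μ A ≤ μ B := by
  have := hadd A (B \ A) Set.disjoint_sdiff_right
  rw [Set.union_sdiff_cancel h] at this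
  linarith [h0 (B \ A)]

theorem sum_mean_le_one (h0 : ∀ A, 0 ≤ μ A) (h1 : μ Set.univ = 1)
    (hadd : ∀ A B, Disjoint A B → μ (A ∪ B) = μ A + μ B) {A : ℕ → Set Ω}
    (hA : ∀ m n, m < n → Disjoint (A m) (A n)) (N : ℕ) : ∑ n ∈ Finset.range N, μ (A n) ≤ 1 := by
  have : ∑ n ∈ Finset.range N, μ (A n) = μ (⋃ n ∈ Finset.range N, A n) := by
    induction N with
    | zero => simp [mean_empty hadd]
    | succ N ih =>
      rw [Finset.sum_range_succ, ih, ← hadd]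
      · congr 1
        ext x
        simp only [Set.mem_union, Set.mem_iUnion, Finset.mem_range, exists_prop,
          Nat.lt_succ_iff_lt_or_eq, or_and_right, exists_or, exists_eq_left]
      · simp only [Set.disjoint_iUnion_left, Finset.mem_range]
        exact fun n hn => hA n N hn
  rw [this, ← h1]
  exact mean_mono h0 hadd (Set.subset_univ _)

/-- Sets of equal mean, of which no three have a common point, have mean zero. -/
theorem mean_eq_zero (h0 : ∀ A, 0 ≤ μ A) (h1 : μ Set.univ = 1)
    (hadd : ∀ A B, Disjoint A B → μ (A ∪ B) = μ A + μ B) {B : ℕ → Set Ω} {c : ℝ}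
    (hc : ∀ n, μ (B n) = c)
    (hB : ∀ k m n, k < m → m < n → ∀ x, x ∈ B k → x ∈ B m → x ∉ B n) : c = 0 := by
  -- Each `B n` is split into the points met for the first time and those met for the second time;
  -- both families are disjoint, so `N` sets have total mean at most 2.
  let P : ℕ → Set Ω := fun n => {x | ∃ m < n, x ∈ B m}
  have hfirst : ∀ m n, m < n → Disjoint (B m \ P m) (B n \ P n) := fun m n hmn =>
    Set.disjoint_left.2 fun x hx hx' => hx'.2 ⟨m, hmn, hx.1⟩
  have hsecond : ∀ m n, m < n → Disjoint (B m ∩ P m) (B n ∩ P n) := fun m n hmn =>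
    Set.disjoint_left.2 fun x ⟨hx, k, hk, hxk⟩ hx' => hB k m n hk hmn x hxk hx hx'.1
  have hsplit : ∀ n, μ (B n ∩ P n) + μ (B n \ P n) = c := fun n => by
    rw [← hc n, ← hadd _ _ Set.disjoint_sdiff_inter.symm, Set.inter_union_sdiff]
  have hbound : ∀ N : ℕ, N * c ≤ 2 := fun N => by
    have h2 := sum_mean_le_one h0 h1 hadd hfirst N
    have h3 := sum_mean_le_one h0 h1 hadd hsecond N
    have h4 : ∑ n ∈ Finset.range N, (μ (B n ∩ P n) + μ (B n \ P n)) = N * c := by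
      simp [hsplit]
    rw [Finset.sum_add_distrib] at h4
    linarith
  refine le_antisymm ?_ (hc 0 ▸ h0 _)
  by_contra! hpos
  obtain ⟨N, hN⟩ := exists_nat_gt (2 / c)
  rw [div_lt_iff₀ hpos] at hN
  linarith [hbound N]

end Mean

/-! ### The criterion for not being inner amenable -/

section InnerAmenable

variable {L X : Type*} [Group L] [MulAction L X]

/-- The elements of `L ∖ {1}` that are concentrated on `Y`: those with a fixed point for which at
least half of `F g` is contained in `Y`, and those without fixed points whose powers move each
point into `Y` eventually. -/
def concentrated (F : L → Set X) (Y : Set X) : Set {g : L // g ≠ 1} :=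
  {g | ((∃ v : X, g.1 • v = v) → (F g).ncard ≤ 2 * (F g ∩ Y).ncard) ∧
    ((∀ v : X, g.1 • v ≠ v) → ∀ v : X, ∀ᶠ n : ℕ in atTop, g.1 ^ n • v ∈ Y)}

theorem conj_mem_concentrated {F : L → Set X} (hF : ∀ p g, F (p * g * p⁻¹) = p • F g) (p : L)
    (Y : Set X) : conjNeOne p '' concentrated F Y ⊆ concentrated F (p • Y) := by
  rintro _ ⟨g, ⟨h1, h2⟩, rfl⟩
  refine ⟨?_, ?_⟩
  · rintro ⟨v, hv⟩
    simp only [conjNeOne, mul_smul, smul_eq_iff_eq_inv_smul p] at hv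
    simp only [conjNeOne, hF, ← Set.smul_set_inter, Set.ncard_smul_set]
    exact h1 ⟨_, hv⟩
  · intro hv v
    have h3 : ∀ u : X, g.1 • u ≠ u := fun u hu => hv (p • u) (by simp [conjNeOne, mul_smul, hu])
    filter_upwards [h2 h3 (p⁻¹ • v)] with n hn
    rw [Set.mem_smul_set_iff_inv_smul_mem]
    simpa [conjNeOne, conj_pow, mul_smul] using hn

/-- Three disjoint sets cannot each contain half of a finite non-empty set. Two can, which is why
`mean_eq_zero` allows double points. -/
theorem not_mem_concentrated [Nonempty X] {F : L → Set X}
    (hfin : ∀ g : L, g ≠ 1 → ∀ v : X, g • v = v → (F g).Finite ∧ (F g).Nonempty)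
    {Y₁ Y₂ Y₃ : Set X} (h12 : Disjoint Y₁ Y₂) (h13 : Disjoint Y₁ Y₃) (h23 : Disjoint Y₂ Y₃)
    {g : {g : L // g ≠ 1}} (h1 : g ∈ concentrated F Y₁) (h2 : g ∈ concentrated F Y₂) :
    g ∉ concentrated F Y₃ := by
  intro h3
  by_cases hg : ∃ v : X, g.1 • v = v
  · obtain ⟨v, hv⟩ := hg
    obtain ⟨hf, hne⟩ := hfin g g.2 v hv
    have hpos := (Set.ncard_pos hf).2 hne
    have e1 := h1.1 ⟨v, hv⟩
    have e2 := h2.1 ⟨v, hv⟩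
    have e3 := h3.1 ⟨v, hv⟩
    have hsub : (F g ∩ Y₁) ∪ (F g ∩ Y₂) ∪ (F g ∩ Y₃) ⊆ F g := by
      rintro x ((hx | hx) | hx) <;> exact hx.1
    have hle := Set.ncard_le_ncard hsub hf
    have fin : ∀ Y, (F g ∩ Y).Finite := fun Y => hf.subset Set.inter_subset_left
    have disj : ∀ {Y Z}, Disjoint Y Z → Disjoint (F g ∩ Y) (F g ∩ Z) := fun h =>
      h.mono Set.inter_subset_right Set.inter_subset_right
    rw [Set.ncard_union_eq (Set.disjoint_union_left.2 ⟨disj h13, disj h23⟩)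
      ((fin _).union (fin _)) (fin _), Set.ncard_union_eq (disj h12) (fin _) (fin _)] at hle
    omega
  · push Not at hg
    obtain ⟨v⟩ := ‹Nonempty X›
    obtain ⟨n, hn1, hn2⟩ := ((h1.2 hg v).and (h2.2 hg v)).exists
    exact Set.disjoint_left.1 h12 hn1 hn2

theorem mean_concentrated_eq_zero [Nonempty X] {μ : Set {g : L // g ≠ 1} → ℝ} (h0 : ∀ A, 0 ≤ μ A)
    (h1 : μ Set.univ = 1) (hadd : ∀ A B, Disjoint A B → μ (A ∪ B) = μ A + μ B)
    (hconj : ∀ (g : L) A, μ (conjNeOne g '' A) = μ A)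
    {F : L → Set X} (hF : ∀ p g, F (p * g * p⁻¹) = p • F g)
    (hfin : ∀ g : L, g ≠ 1 → ∀ v : X, g • v = v → (F g).Finite ∧ (F g).Nonempty)
    {Y : Set X} {p : ℕ → L} (hp : ∀ m n, m < n → Disjoint (p m • Y) (p n • Y)) :
    μ (concentrated F Y) = 0 := by
  refine mean_eq_zero h0 h1 hadd (B := fun n => conjNeOne (p n) '' concentrated F Y)
    (fun n => hconj _ _) fun k m n hkm hmn x hk hm hn => ?_
  exact not_mem_concentrated hfin (hp k m hkm) (hp k n (hkm.trans hmn)) (hp m n hmn)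
    (conj_mem_concentrated hF _ _ hk) (conj_mem_concentrated hF _ _ hm)
    (conj_mem_concentrated hF _ _ hn)

/-- A criterion for not being inner amenable: each non-trivial element with a fixed point
determines a finite set of points, the powers of each element without fixed points move all points
into `Y` or all points out of `Y`, and both `Y` and its complement have infinitely many disjoint
translates. -/
theorem not_innerAmenable_of_action [Nonempty X] {F : L → Set X}
    (hF : ∀ p g, F (p * g * p⁻¹) = p • F g)
    (hfin : ∀ g : L, g ≠ 1 → ∀ v : X, g • v = v → (F g).Finite ∧ (F g).Nonempty) {Y : Set X}
    (hY : ∀ g : L, (∀ v : X, g • v ≠ v) → (∀ v : X, ∀ᶠ n : ℕ in atTop, g ^ n • v ∈ Y) ∨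
      ∀ v : X, ∀ᶠ n : ℕ in atTop, g ^ n • v ∈ Yᶜ)
    (hp : ∃ p : ℕ → L, ∀ m n, m < n → Disjoint (p m • Y) (p n • Y))
    (hq : ∃ q : ℕ → L, ∀ m n, m < n → Disjoint (q m • Yᶜ) (q n • Yᶜ)) :
    ¬ InnerAmenable L := by
  rintro ⟨μ, h0, h1, hadd, hconj⟩
  obtain ⟨p, hp⟩ := hp
  obtain ⟨q, hq⟩ := hq
  have e1 := mean_concentrated_eq_zero h0 h1 hadd hconj hF hfin hp
  have e2 := mean_concentrated_eq_zero h0 h1 hadd hconj hF hfin hq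
  have hcover : (concentrated F Y)ᶜ ⊆ concentrated F Yᶜ := by
    intro g hg
    by_cases hv : ∃ v : X, g.1 • v = v
    · refine ⟨fun _ => ?_, fun h => absurd hv (by simpa using h)⟩
      by_contra! hlt
      refine hg ⟨fun _ => ?_, fun h => absurd hv (by simpa using h)⟩
      obtain ⟨v, hv⟩ := hv
      -- If neither `Y` nor its complement contained half of `F g`, the two parts would not add up
      -- to `F g`.
      have := Set.ncard_inter_add_ncard_sdiff_eq_ncard (F g) Y (hfin g g.2 v hv).1
      rw [Set.sdiff_eq] at this
      omega
    · refine ⟨fun h => absurd h hv, fun h => (hY g h).resolve_left fun h' => ?_⟩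
      exact hg ⟨fun h => absurd h hv, fun _ => h'⟩
  have e3 := hadd _ _ (disjoint_compl_right (a := concentrated F Y))
  rw [Set.union_compl_self, h1, e1] at e3
  linarith [mean_mono h0 hadd hcover]

end InnerAmenable

end HNNFamily

theorem mainTheorem7 {I : ℤˣ → Type*} (ι : ∀ ε, I ε) (S : ∀ ε, Subgroup (Equiv.Perm (I ε)))
    (hI : ∀ ε, ∃ i : I ε, i ≠ ι ε)
    (hS : ∀ ε, ∀ i j : I ε, ∃ σ ∈ S ε, σ i = j) :
    ¬ HNNFamily.InnerAmenable (HNNFamily.HNNGroup ι S) :=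
  haveI : Nonempty (HNNFamily.Vertex ι) := ⟨HNNFamily.root⟩
  HNNFamily.not_innerAmenable_of_action HNNFamily.smul_fixBoundary
    (fun _ hg _ hv => HNNFamily.fixBoundary_finite_nonempty hS hg hv)
    -- The sign `1` is an arbitrary choice: either half-tree would serve.
    (fun _ hg => HNNFamily.eventually_mem_halfTree hS hg 1)
    (HNNFamily.exists_disjoint_smul_halfTree hI hS 1)
    (HNNFamily.exists_disjoint_smul_compl_halfTree hI hS 1)
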